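/- Let $A,B\ge 1$ and let $F_i(x)=O^\lambda_i\lambda_i x+b_i$ ($1\le i\le A$) and $G_j(x)=O^\gamma_j\gamma_j x+c_j$ ($1\le j\le B$) be two iterated function systems on $\mathbb{R}$, where $O^\lambda_i,O^\gamma_j\in\{1,-1\}$, $0<\lambda_i,\gamma_j<1$ and $b_i,c_j\in\mathbb{R}$. Let $C_\lambda$ and $C_\gamma$ be their attractors, i.e. the unique nonempty compact sets with $C_\lambda=\bigcup_i F_i(C_\lambda)$ and $C_\gamma=\bigcup_j G_j(C_\gamma)$, and assume that $C_\lambda$ and $C_\gamma$ are not both one-point sets. Let $d_\lambda,d_\gamma$ be the similarity dimensions, i.e. the real numbers with $\sum_i\lambda_i^{d_\lambda}=1$ and $\sum_j\gamma_j^{d_\gamma}=1$, and let $D=\max\{\operatorname{diam} C_\lambda,\operatorname{diam} C_\gamma\}$. For a finite word $u=u_1\cdots u_n$ over $\{1,\dots,A\}$ put $\lambda_u=\lambda_{u_1}\cdots\lambda_{u_n}$, $O^\lambda_u=O^\lambda_{u_1}\cdots O^\lambda_{u_n}$, and define $\gamma_v$, $O^\gamma_v$ in the same way for a word $v$ over $\{1,\dots,B\}$.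 For infinite sequences $\omega,\tau$ over these alphabets let $\Pi_\lambda(\omega)=\lim_{n\to\infty}F_{\omega_1}\circ\cdots\circ F_{\omega_n}(0)$, $\Pi_\gamma(\tau)=\lim_{n\to\infty}G_{\tau_1}\circ\cdots\circ G_{\tau_n}(0)$ and $L(\omega,\tau)=\Pi_\lambda(\omega)+\Pi_\gamma(\tau)$; let $u\bar 1$ be the word $u$ followed by infinitely many digits $1$. A pair of words $u\times v$ is called a $\delta$-square if $\lambda_u/\gamma_v\in(e^{-\delta},e^{\delta})$. Two pairs $u_1\times v_1$ and $u_2\times v_2$ are called $\epsilon$-relatively close if (i) $\lambda_{u_1}/\lambda_{u_2}\in(e^{-\epsilon},e^{\epsilon})$ and $\gamma_{v_1}/\gamma_{v_2}\in(e^{-\epsilon},e^{\epsilon})$; (ii) $O^\lambda_{u_1}=O^\lambda_{u_2}$ and $O^\gamma_{v_1}=O^\gamma_{v_2}$; (iii) $|L(u_1\bar 1,v_1\bar 1)-L(u_2\bar 1,v_2\bar 1)|<\epsilon D\min\{\lambda_{u_1},\lambda_{u_2},\gamma_{v_1},\gamma_{v_2}\}$. Then $\mathcal{H}^{d_\lambda+d_\gamma}(C_\lambda+C_\gamma)=0$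 if and only if for every $\epsilon>0$ there exist two distinct $\epsilon$-relatively close $\epsilon$-squares. -/

import Mathlib

open scoped Pointwise

/-- A finite iterated function system of contracting similarities of the line,
`F i x = sign i * ratio i * x + shift i`, with `sign i = ±1` and `0 < ratio i < 1`. -/
structure AffineIFS (A : ℕ) where
  /-- orientations -/
  sign : Fin A → ℝ
  /-- contraction rates -/
  ratio : Fin A → ℝ
  /-- translations -/
  shift : Fin A → ℝ
  sign_eq : ∀ i, sign i = 1 ∨ sign i = -1
  ratio_pos : ∀ i, 0 < ratio i
  ratio_lt_one : ∀ i, ratio i < 1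

namespace AffineIFS

variable {A B : ℕ}

/-- The `i`-th map of the system. -/
def map (F : AffineIFS A) (i : Fin A) (x : ℝ) : ℝ :=
  F.sign i * F.ratio i * x + F.shift i

/-- `K` is the attractor of the system: the (unique) nonempty compact set that is the union of its
images under the maps of the system. -/
def IsAttractor (F : AffineIFS A) (K : Set ℝ) : Prop :=
  K.Nonempty ∧ IsCompact K ∧ K = ⋃ i, F.map i '' K

/-- `d` is the similarity dimension of the system: `∑ i, (ratio i) ^ d = 1`. -/
def IsSimilarityDim (F : AffineIFS A) (d : ℝ) : Prop :=
  ∑ i, F.ratio i ^ d = 1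

/-- The contraction rate of a word: the product of the rates of its digits. -/
def wordRatio (F : AffineIFS A) (u : List (Fin A)) : ℝ := (u.map F.ratio).prod

/-- The orientation of a word: the product of the orientations of its digits. -/
def wordSign (F : AffineIFS A) (u : List (Fin A)) : ℝ := (u.map F.sign).prod

/-- The composition `F_{u₁} ∘ F_{u₂} ∘ ⋯ ∘ F_{uₙ}` along a word. -/
def wordMap (F : AffineIFS A) (u : List (Fin A)) (x : ℝ) : ℝ := u.foldr F.map x

/-- The natural projection from infinite sequences of digits to the attractor,
`ω ↦ lim F_{ω₁} ∘ ⋯ ∘ F_{ωₙ} (0)`; the limit exists by `tendsto_proj`. -/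
noncomputable def proj (F : AffineIFS A) (ω : ℕ → Fin A) : ℝ :=
  Filter.limUnder Filter.atTop fun n : ℕ => F.wordMap ((List.range n).map ω) 0

theorem wordMap_sub (F : AffineIFS A) (u : List (Fin A)) (x y : ℝ) :
    F.wordMap u x - F.wordMap u y = F.wordSign u * F.wordRatio u * (x - y) := by
  induction u with
  | nil => simp [wordMap, wordSign, wordRatio]
  | cons i u ih =>
    have h : F.map i (F.wordMap u x) - F.map i (F.wordMap u y)
        = F.sign i * F.ratio i * (F.wordMap u x - F.wordMap u y) := by
      simp only [map]; ring
    have hx : ∀ z, F.wordMap (i :: u) z = F.map i (F.wordMap u z) := fun z => rfl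
    rw [hx, hx, h, ih]
    simp only [wordSign, wordRatio, List.map_cons, List.prod_cons]
    ring

theorem tendsto_proj (F : AffineIFS A) (ω : ℕ → Fin A) :
    Filter.Tendsto (fun n : ℕ => F.wordMap ((List.range n).map ω) 0) Filter.atTop
      (nhds (F.proj ω)) := by
  have hne : (Finset.univ : Finset (Fin A)).Nonempty := ⟨ω 0, Finset.mem_univ _⟩
  obtain ⟨i₀, -, hi₀⟩ := Finset.exists_max_image _ F.ratio hne
  obtain ⟨i₁, -, hi₁⟩ := Finset.exists_max_image _ (fun i => |F.shift i|) hne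
  have hsign : ∀ u : List (Fin A), |F.wordSign u| = 1 := by
    intro u
    induction u with
    | nil => simp [wordSign]
    | cons i u ih =>
      have : F.wordSign (i :: u) = F.sign i * F.wordSign u := by simp [wordSign]
      rw [this, abs_mul, ih]
      rcases F.sign_eq i with h | h <;> simp [h]
  have hratio : ∀ u : List (Fin A), 0 ≤ F.wordRatio u ∧ F.wordRatio u ≤ F.ratio i₀ ^ u.length := by
    intro u
    induction u with
    | nil => simp [wordRatio]
    | cons i u ih =>
      have : F.wordRatio (i :: u) = F.ratio i * F.wordRatio u := by simp [wordRatio]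
      rw [this, List.length_cons, pow_succ']
      exact ⟨mul_nonneg (F.ratio_pos i).le ih.1,
        mul_le_mul (hi₀ i (Finset.mem_univ _)) ih.2 ih.1 (F.ratio_pos i₀).le⟩
  refine CauchySeq.tendsto_limUnder (cauchySeq_of_le_geometric (F.ratio i₀) |F.shift i₁|
    (F.ratio_lt_one i₀) fun n => ?_)
  have hstep : F.wordMap ((List.range (n + 1)).map ω) 0
      = F.wordMap ((List.range n).map ω) (F.shift (ω n)) := by
    simp [wordMap, List.range_succ, map]
  rw [hstep, Real.dist_eq, wordMap_sub, abs_mul, abs_mul, hsign, one_mul,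
    abs_of_nonneg (hratio _).1, zero_sub, abs_neg, mul_comm]
  have h2 := (hratio ((List.range n).map ω)).2
  rw [List.length_map, List.length_range] at h2
  exact mul_le_mul (hi₁ _ (Finset.mem_univ _)) h2 (hratio _).1 (abs_nonneg _)

/-- The infinite sequence `u 1̄`: the word `u` followed by infinitely many copies of the first
digit, which is `0` in `Fin A`. -/
def extend [NeZero A] (u : List (Fin A)) : ℕ → Fin A := fun n => u.getD n 0

/-- The map `(ω, τ) ↦ Π_F ω + Π_G τ` from pairs of sequences onto the sum of the attractors. -/
noncomputable def sumProj (F : AffineIFS A) (G : AffineIFS B) (ω : ℕ → Fin A) (τ : ℕ → Fin B) :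
    ℝ :=
  F.proj ω + G.proj τ

/-- A pair of words `u × v` is a `δ`-square if `λ_u / γ_v ∈ (e^{-δ}, e^δ)`. -/
def IsDeltaSquare (F : AffineIFS A) (G : AffineIFS B) (δ : ℝ) (w : List (Fin A) × List (Fin B)) :
    Prop :=
  F.wordRatio w.1 / G.wordRatio w.2 ∈ Set.Ioo (Real.exp (-δ)) (Real.exp δ)

/-- `u₁ × v₁` and `u₂ × v₂` are `ε`-relatively close; `D` is the larger one of the diameters
of the two attractors. -/
def RelativelyClose [NeZero A] [NeZero B] (F : AffineIFS A) (G : AffineIFS B) (D ε : ℝ)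
    (w₁ w₂ : List (Fin A) × List (Fin B)) : Prop :=
  (F.wordRatio w₁.1 / F.wordRatio w₂.1 ∈ Set.Ioo (Real.exp (-ε)) (Real.exp ε) ∧
    G.wordRatio w₁.2 / G.wordRatio w₂.2 ∈ Set.Ioo (Real.exp (-ε)) (Real.exp ε)) ∧
  (F.wordSign w₁.1 = F.wordSign w₂.1 ∧ G.wordSign w₁.2 = G.wordSign w₂.2) ∧
  |sumProj F G (extend w₁.1) (extend w₁.2) - sumProj F G (extend w₂.1) (extend w₂.2)| <
    ε * D * min (min (F.wordRatio w₁.1) (F.wordRatio w₂.1))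
      (min (G.wordRatio w₁.2) (G.wordRatio w₂.2))

end AffineIFS

/-! Give a pair of words `u × v` the mass `λ_u^{d₁} γ_v^{d₂}`. This is the measure of the rectangle
of sequence pairs starting with `u` and `v`, for a product of Bernoulli measures
(`exists_product_bernoulli`). A rectangle with both rates comparable to `r` has mass comparable to
`r^{d₁+d₂}` and an image in `C₁ + C₂` of diameter at most a constant times `r`. So the question is
whether many disjoint rectangles of one size can have nearly the same image.

Suppose that for some `ε` there are no close squares. Each rectangle of size `r` contains an
orientation preserving `ε`-square of comparable size (`exists_uniform_balanced_extension`). If too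
many rectangles of size `r` met one set of diameter `r`, two of these squares would share
approximate rates, orientations and positions, hence be relatively close. So the number is bounded
(`exists_packing_bound`), and the mass distribution principle makes the Hausdorff measure positive
(`hausdorffMeasure_pos_of_packing_bound`).

Conversely, a pair of very close squares is a cluster of two disjoint rectangles with almost the
same affine map. Concatenating such pairs, each outer one far narrower than what it precedes, gives
clusters of `2^k` rectangles (`HasCloseSquares.exists_cluster`). One interval covers the image of a
cluster, so its Hausdorff content is at most a constant times `2^{-k}` per unit of mass. A copy of
the cluster fills a fixed proportion of every rectangle of bounded eccentricity. Treating the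
remainder in the same way again and again (`content_image_rect_le`) gives all these rectangles a
bound of order `2^{-k}`. Letting `k` grow, the content of `C₁ + C₂` vanishes, and with it the
Hausdorff measure. -/

namespace AffineIFS

variable {A B : ℕ}

/-! ### Rates, orientations and affine maps of finite words. -/

section words

variable (F : AffineIFS A)

@[simp] theorem wordRatio_nil : F.wordRatio [] = 1 := by simp [wordRatio]

@[simp] theorem wordSign_nil : F.wordSign [] = 1 := by simp [wordSign]

@[simp] theorem wordMap_nil (x : ℝ) : F.wordMap [] x = x := rfl

theorem wordRatio_append (u v : List (Fin A)) :
    F.wordRatio (u ++ v) = F.wordRatio u * F.wordRatio v := by simp [wordRatio]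

theorem wordSign_append (u v : List (Fin A)) :
    F.wordSign (u ++ v) = F.wordSign u * F.wordSign v := by simp [wordSign]

theorem wordMap_append (u v : List (Fin A)) (x : ℝ) :
    F.wordMap (u ++ v) x = F.wordMap u (F.wordMap v x) := by simp [wordMap]

theorem wordRatio_pos (u : List (Fin A)) : 0 < F.wordRatio u := by
  refine List.prod_pos fun a ha => ?_
  obtain ⟨i, -, rfl⟩ := List.mem_map.1 ha
  exact F.ratio_pos i

theorem wordSign_eq (u : List (Fin A)) : F.wordSign u = 1 ∨ F.wordSign u = -1 := by
  induction u with
  | nil => simp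
  | cons i u ih =>
    have : F.wordSign (i :: u) = F.sign i * F.wordSign u := by simp [wordSign]
    rw [this]
    rcases F.sign_eq i with h | h <;> rcases ih with h' | h' <;> simp [h, h']

theorem wordSign_mul_self (u : List (Fin A)) : F.wordSign u * F.wordSign u = 1 := by
  rcases F.wordSign_eq u with h | h <;> simp [h]

theorem abs_wordSign (u : List (Fin A)) : |F.wordSign u| = 1 := by
  rcases F.wordSign_eq u with h | h <;> simp [h]

theorem wordRatio_le_one (u : List (Fin A)) : F.wordRatio u ≤ 1 := by
  induction u with
  | nil => simp
  | cons i u ih =>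
    have : F.wordRatio (i :: u) = F.ratio i * F.wordRatio u := by simp [wordRatio]
    rw [this]
    exact mul_le_one₀ (F.ratio_lt_one i).le (F.wordRatio_pos u).le ih

theorem exists_ratio_bounds : ∃ m M : ℝ, 0 < m ∧ m < 1 ∧ 0 < M ∧ M < 1 ∧
    ∀ i, m ≤ F.ratio i ∧ F.ratio i ≤ M := by
  rcases isEmpty_or_nonempty (Fin A) with h | h
  · exact ⟨1 / 2, 1 / 2, by norm_num, by norm_num, by norm_num, by norm_num, fun i => h.elim i⟩
  · obtain ⟨i₀, hi₀⟩ := Finite.exists_max F.ratio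
    obtain ⟨i₁, hi₁⟩ := Finite.exists_min F.ratio
    exact ⟨F.ratio i₁, F.ratio i₀, F.ratio_pos _, F.ratio_lt_one _, F.ratio_pos _,
      F.ratio_lt_one _, fun i => ⟨hi₁ i, hi₀ i⟩⟩

theorem exists_common_ratio_bound (G : AffineIFS B) : ∃ m : ℝ, 0 < m ∧ m < 1 ∧
    (∀ i, m ≤ F.ratio i) ∧ ∀ i, m ≤ G.ratio i := by
  obtain ⟨m₁, _, h₁, h₁', _, _, hF⟩ := F.exists_ratio_bounds
  obtain ⟨m₂, _, h₂, _, _, _, hG⟩ := G.exists_ratio_bounds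
  exact ⟨min m₁ m₂, lt_min h₁ h₂, (min_le_left _ _).trans_lt h₁',
    fun i => (min_le_left _ _).trans (hF i).1, fun i => (min_le_right _ _).trans (hG i).1⟩

variable {F} in
theorem pow_length_le_wordRatio {m : ℝ} (hm : 0 < m) (h : ∀ i, m ≤ F.ratio i)
    (u : List (Fin A)) : m ^ u.length ≤ F.wordRatio u := by
  induction u with
  | nil => simp
  | cons i u ih =>
    have : F.wordRatio (i :: u) = F.ratio i * F.wordRatio u := by simp [wordRatio]
    rw [this, List.length_cons, pow_succ']
    exact mul_le_mul (h i) ih (by positivity) (F.ratio_pos i).le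

variable {F} in
theorem wordRatio_le_pow_length {M : ℝ} (h : ∀ i, F.ratio i ≤ M)
    (u : List (Fin A)) : F.wordRatio u ≤ M ^ u.length := by
  induction u with
  | nil => simp
  | cons i u ih =>
    have : F.wordRatio (i :: u) = F.ratio i * F.wordRatio u := by simp [wordRatio]
    rw [this, List.length_cons, pow_succ']
    exact mul_le_mul (h i) ih (F.wordRatio_pos u).le ((F.ratio_pos i).le.trans (h i))

variable {F} in
theorem wordRatio_le_of_ne_nil {M : ℝ} (h : ∀ i, F.ratio i ≤ M)
    {u : List (Fin A)} (hu : u ≠ []) : F.wordRatio u ≤ M := by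
  cases u with
  | nil => exact absurd rfl hu
  | cons i u =>
    have : F.wordRatio (i :: u) = F.ratio i * F.wordRatio u := by simp [wordRatio]
    rw [this]
    exact (mul_le_of_le_one_right (F.ratio_pos i).le (F.wordRatio_le_one u)).trans (h i)

/-- The linear part of the composition along a word. -/
def wordLin (u : List (Fin A)) : ℝ := F.wordSign u * F.wordRatio u

theorem abs_wordLin (u : List (Fin A)) : |F.wordLin u| = F.wordRatio u := by
  rw [wordLin, abs_mul, abs_wordSign, one_mul, abs_of_pos (F.wordRatio_pos u)]

theorem wordLin_append (u v : List (Fin A)) :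
    F.wordLin (u ++ v) = F.wordLin u * F.wordLin v := by
  simp only [wordLin, wordSign_append, wordRatio_append]; ring

theorem wordMap_eq (u : List (Fin A)) (x : ℝ) :
    F.wordMap u x = F.wordLin u * x + F.wordMap u 0 := by
  have := F.wordMap_sub u x 0
  rw [sub_zero] at this
  rw [wordLin, ← this]; ring

theorem continuous_wordMap (u : List (Fin A)) : Continuous (F.wordMap u) := by
  have : F.wordMap u = fun x => F.wordLin u * x + F.wordMap u 0 := funext (F.wordMap_eq u)
  rw [this]
  fun_prop

end words

/-! ### Cylinders and rectangles in sequence space. -/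

section cylinders

variable {α : Type*}

/-- The first `n` terms of a sequence. -/
def digits (ω : ℕ → α) (n : ℕ) : List α := (List.range n).map ω

/-- The set of sequences that start with a given word. -/
def cylinder (u : List α) : Set (ℕ → α) := {ω | digits ω u.length = u}

@[simp] theorem length_digits (ω : ℕ → α) (n : ℕ) : (digits ω n).length = n := by simp [digits]

theorem digits_add (ω : ℕ → α) (m n : ℕ) :
    digits ω (m + n) = digits ω m ++ digits (fun k => ω (m + k)) n := by
  simp [digits, List.range_add, Function.comp_def]

theorem digits_succ (ω : ℕ → α) (n : ℕ) : digits ω (n + 1) = digits ω n ++ [ω n] := by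
  simp [digits, List.range_succ]

theorem mem_cylinder_digits (ω : ℕ → α) (n : ℕ) : ω ∈ cylinder (digits ω n) := by
  simp [cylinder]

theorem mem_cylinder_append {ω : ℕ → α} {u v : List α} :
    ω ∈ cylinder (u ++ v) ↔ ω ∈ cylinder u ∧ (fun k => ω (u.length + k)) ∈ cylinder v := by
  simp only [cylinder, Set.mem_ofPred_eq, List.length_append, digits_add]
  constructor
  · intro h
    exact List.append_inj h (by simp)
  · rintro ⟨h₁, h₂⟩
    rw [h₁, h₂]

theorem cylinder_append_subset (u v : List α) : cylinder (u ++ v) ⊆ cylinder u :=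
  fun _ h => (mem_cylinder_append.1 h).1

theorem digits_prefix (ω : ℕ → α) {m n : ℕ} (h : m ≤ n) : digits ω m <+: digits ω n := by
  obtain ⟨k, rfl⟩ := Nat.exists_eq_add_of_le h
  rw [digits_add]
  exact List.prefix_append _ _

theorem eq_digits_of_prefix {ω : ℕ → α} {n : ℕ} {v : List α} (h : v <+: digits ω n) :
    v = digits ω v.length := by
  have hl := h.length_le
  rw [length_digits] at hl
  exact List.IsPrefix.eq_of_length (List.prefix_of_prefix_length_le h (digits_prefix ω hl)
    (by simp)) (by simp)

theorem prefix_or_prefix_of_mem {ω : ℕ → α} {u v : List α} (hu : ω ∈ cylinder u)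
    (hv : ω ∈ cylinder v) : u <+: v ∨ v <+: u := by
  rw [cylinder, Set.mem_ofPred_eq] at hu hv
  rcases le_total u.length v.length with h | h
  · left; rw [← hu, ← hv]; exact digits_prefix ω h
  · right; rw [← hu, ← hv]; exact digits_prefix ω h

theorem cylinder_subset_or_disjoint {u v : List α} (h : u.length ≤ v.length) :
    cylinder v ⊆ cylinder u ∨ Disjoint (cylinder v) (cylinder u) := by
  by_cases hd : Disjoint (cylinder v) (cylinder u)
  · exact Or.inr hd
  · left
    obtain ⟨ω, hv, hu⟩ := Set.not_disjoint_iff.1 hd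
    have hp : u <+: v := by
      rcases prefix_or_prefix_of_mem hu hv with h' | h'
      · exact h'
      · rw [h'.eq_of_length (le_antisymm h'.length_le h)]
    obtain ⟨t, rfl⟩ := hp
    exact cylinder_append_subset _ _

theorem measurableSet_cylinder [MeasurableSpace α] [MeasurableSingletonClass α] (u : List α) :
    MeasurableSet (cylinder u) := by
  have : cylinder u = ⋂ i : Fin u.length, (fun ω : ℕ → α => ω i) ⁻¹' {u[i]} := by
    ext ω
    simp only [cylinder, Set.mem_ofPred_eq, Set.mem_iInter, Set.mem_preimage,
      Set.mem_singleton_iff, digits]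
    constructor
    · intro h i
      have := congrArg (fun l : List α => l[i]?) h
      simpa using this
    · intro h
      refine List.ext_getElem (by simp) fun i h₁ h₂ => ?_
      simpa using h ⟨i, h₂⟩
  rw [this]
  exact MeasurableSet.iInter fun i => measurable_pi_apply _ (measurableSet_singleton _)

theorem extend_mem_cylinder [NeZero A] (u : List (Fin A)) : extend u ∈ cylinder u := by
  simp only [cylinder, Set.mem_ofPred_eq, digits]
  refine List.ext_getElem (by simp) fun i h₁ h₂ => ?_
  simp [extend, List.getElem?_eq_getElem h₂]

theorem extend_shift [NeZero A] (u : List (Fin A)) :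
    (fun k => extend u (u.length + k)) = extend ([] : List (Fin A)) := by
  funext k
  simp [extend]

/-- The product of two cylinders. -/
def rect {β : Type*} (w : List α × List β) : Set ((ℕ → α) × (ℕ → β)) :=
  cylinder w.1 ×ˢ cylinder w.2

/-- Concatenation of pairs of words. -/
def pairAppend {β : Type*} (w w' : List α × List β) : List α × List β :=
  (w.1 ++ w'.1, w.2 ++ w'.2)

theorem rect_append_subset {β : Type*} (w w' : List α × List β) :
    rect (pairAppend w w') ⊆ rect w :=
  Set.prod_mono (cylinder_append_subset _ _) (cylinder_append_subset _ _)

theorem disjoint_rect_append {β : Type*} (p : List α × List β) {w w' : List α × List β}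
    (h : Disjoint (rect w) (rect w')) :
    Disjoint (rect (pairAppend p w)) (rect (pairAppend p w')) := by
  rw [Set.disjoint_left] at h ⊢
  rintro ⟨ω, τ⟩ ⟨h₁, h₂⟩ ⟨h₃, h₄⟩
  exact h (a := (fun k => ω (p.1.length + k), fun k => τ (p.2.length + k)))
    ⟨(mem_cylinder_append.1 h₁).2, (mem_cylinder_append.1 h₂).2⟩
    ⟨(mem_cylinder_append.1 h₃).2, (mem_cylinder_append.1 h₄).2⟩

theorem measurableSet_rect {β : Type*} [MeasurableSpace α] [MeasurableSingletonClass α]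
    [MeasurableSpace β] [MeasurableSingletonClass β] (w : List α × List β) :
    MeasurableSet (rect w) :=
  (measurableSet_cylinder _).prod (measurableSet_cylinder _)

end cylinders

/-! ### The coding of the attractor by sequences. -/

section projection

variable (F : AffineIFS A)

theorem proj_eq_wordMap (ω : ℕ → Fin A) (n : ℕ) :
    F.proj ω = F.wordMap (digits ω n) (F.proj fun k => ω (n + k)) := by
  have h₁ := (F.tendsto_proj ω).comp (Filter.tendsto_add_atTop_nat n)
  have h₂ := ((F.continuous_wordMap (digits ω n)).tendsto _).comp
    (F.tendsto_proj fun k => ω (n + k))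
  refine tendsto_nhds_unique h₁ (h₂.congr fun k => ?_)
  have := digits_add ω n k
  simp only [Function.comp_apply]
  change _ = F.wordMap (digits ω (k + n)) 0
  rw [add_comm k n, this, wordMap_append]
  rfl

theorem proj_eq_of_mem_cylinder {ω : ℕ → Fin A} {u : List (Fin A)} (h : ω ∈ cylinder u) :
    F.proj ω = F.wordMap u (F.proj fun k => ω (u.length + k)) := by
  rw [F.proj_eq_wordMap ω u.length, show digits ω u.length = u from h]

theorem proj_extend [NeZero A] (u : List (Fin A)) :
    F.proj (extend u) = F.wordMap u (F.proj (extend [])) := by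
  rw [F.proj_eq_of_mem_cylinder (extend_mem_cylinder u), extend_shift]

theorem tendsto_wordRatio_digits (ω : ℕ → Fin A) :
    Filter.Tendsto (fun n => F.wordRatio (digits ω n)) Filter.atTop (nhds 0) := by
  obtain ⟨m, M, -, -, hM, hM1, h⟩ := F.exists_ratio_bounds
  refine squeeze_zero (fun n => (F.wordRatio_pos _).le) (fun n => ?_)
    (tendsto_pow_atTop_nhds_zero_of_lt_one hM.le hM1)
  simpa using wordRatio_le_pow_length (fun i => (h i).2) (digits ω n)

/-- The linear parts tend to zero, so the base point is irrelevant and may even vary with `n` within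
a bounded set. -/
theorem tendsto_wordMap_digits (ω : ℕ → Fin A) {x : ℕ → ℝ} {X : ℝ} (hx : ∀ n, |x n| ≤ X) :
    Filter.Tendsto (fun n => F.wordMap (digits ω n) (x n)) Filter.atTop (nhds (F.proj ω)) := by
  have h : Filter.Tendsto (fun n => F.wordLin (digits ω n) * x n) Filter.atTop (nhds 0) := by
    refine squeeze_zero_norm (a := fun n => F.wordRatio (digits ω n) * X) (fun n => ?_) ?_
    · rw [norm_mul, Real.norm_eq_abs, Real.norm_eq_abs, abs_wordLin]
      exact mul_le_mul_of_nonneg_left (hx n) (F.wordRatio_pos _).le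
    · simpa using (F.tendsto_wordRatio_digits ω).mul_const X
  have := h.add (F.tendsto_proj ω)
  rw [zero_add] at this
  exact this.congr fun n => (F.wordMap_eq _ _).symm

variable {F} {C : Set ℝ}

theorem IsAttractor.wordMap_mem (h : F.IsAttractor C) (u : List (Fin A)) {x : ℝ} (hx : x ∈ C) :
    F.wordMap u x ∈ C := by
  induction u with
  | nil => exact hx
  | cons i u ih =>
    rw [h.2.2]
    exact Set.mem_iUnion.2 ⟨i, F.wordMap u x, ih, rfl⟩

theorem IsAttractor.exists_bound (h : F.IsAttractor C) : ∃ X : ℝ, 0 < X ∧ ∀ x ∈ C, |x| ≤ X := by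
  obtain ⟨X, hX⟩ := h.2.1.isBounded.exists_norm_le
  exact ⟨max X 1, by positivity, fun x hx => (hX x hx).trans (le_max_left _ _)⟩

theorem IsAttractor.proj_mem (h : F.IsAttractor C) (ω : ℕ → Fin A) : F.proj ω ∈ C := by
  obtain ⟨x, hx⟩ := h.1
  exact h.2.1.isClosed.mem_of_tendsto (F.tendsto_wordMap_digits ω (x := fun _ => x)
    (fun _ => le_rfl)) (Filter.Eventually.of_forall fun n => h.wordMap_mem _ hx)

theorem IsAttractor.exists_proj_eq (h : F.IsAttractor C) {x : ℝ} (hx : x ∈ C) :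
    ∃ ω, F.proj ω = x := by
  have step : ∀ y : C, ∃ (i : Fin A) (z : C), F.map i z = y := by
    rintro ⟨y, hy⟩
    rw [h.2.2] at hy
    obtain ⟨i, z, hz, hzy⟩ := Set.mem_iUnion.1 hy
    exact ⟨i, ⟨z, hz⟩, hzy⟩
  choose i z hz using step
  -- A backward orbit of `x`: its points stay in the bounded set `C`, and the inverse branches used
  -- are the digits of a code for `x`.
  let y : ℕ → C := fun n => z^[n] ⟨x, hx⟩
  let ω : ℕ → Fin A := fun n => i (y n)
  obtain ⟨X, -, hX⟩ := h.exists_bound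
  have key : ∀ n, F.wordMap (digits ω n) (y n) = x := by
    intro n
    induction n with
    | zero => rfl
    | succ n ih =>
      rw [digits_succ, wordMap_append, ← ih]
      congr 1
      have : y (n + 1) = z (y n) := Function.iterate_succ_apply' _ _ _
      rw [this, ← hz (y n)]
      rfl
  refine ⟨ω, tendsto_nhds_unique (F.tendsto_wordMap_digits ω (x := fun n => y n)
    (fun n => hX _ (y n).2)) ?_⟩
  simp only [key]
  exact tendsto_const_nhds

theorem measurable_proj (F : AffineIFS A) : Measurable F.proj := by
  have h : ∀ l : List ℕ, Measurable fun ω : ℕ → Fin A => F.wordMap (l.map ω) 0 := by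
    intro l
    induction l with
    | nil => exact measurable_const
    | cons k l ih =>
      have hk : Measurable fun ω : ℕ → Fin A => ω k := measurable_pi_apply k
      exact ((((measurable_of_finite F.sign).comp hk).mul
        ((measurable_of_finite F.ratio).comp hk)).mul ih).add
        ((measurable_of_finite F.shift).comp hk)
  exact measurable_of_tendsto_metrizable (fun n => h (List.range n))
    (tendsto_pi_nhds.2 fun ω => F.tendsto_proj ω)

end projection

/-! ### Cutting sequences at a given scale. -/

section stopping

variable (F : AffineIFS A)

/-- The words that are the first prefixes of sequences with contraction rate at most `r`. -/
def stoppingWords (r : ℝ) : Set (List (Fin A)) :=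
  {u | F.wordRatio u ≤ r ∧ ∀ v, v <+: u → v ≠ u → r < F.wordRatio v}

theorem exists_mem_stoppingWords {r : ℝ} (hr : 0 < r) (ω : ℕ → Fin A) :
    ∃ u ∈ F.stoppingWords r, ω ∈ cylinder u := by
  have h : ∃ n, F.wordRatio (digits ω n) ≤ r :=
    ((F.tendsto_wordRatio_digits ω).eventually (ge_mem_nhds hr)).exists
  classical
  refine ⟨digits ω (Nat.find h), ⟨Nat.find_spec h, fun v hv hne => ?_⟩, mem_cylinder_digits _ _⟩
  have hlt : v.length < Nat.find h := by
    have hl := hv.length_le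
    rw [length_digits] at hl
    refine lt_of_le_of_ne hl fun h' => hne (hv.eq_of_length (by simpa using h'))
  rw [eq_digits_of_prefix hv]
  exact not_le.1 (Nat.find_min h hlt)

variable {F} {r : ℝ} {u v : List (Fin A)}

theorem eq_of_mem_stoppingWords_of_prefix (hu : u ∈ F.stoppingWords r)
    (hv : v ∈ F.stoppingWords r) (h : u <+: v) : u = v := by
  by_contra hne
  exact absurd hu.1 (not_le.2 (hv.2 u h hne))

theorem eq_of_mem_stoppingWords (hu : u ∈ F.stoppingWords r)
    (hv : v ∈ F.stoppingWords r) {ω : ℕ → Fin A} (h₁ : ω ∈ cylinder u) (h₂ : ω ∈ cylinder v) :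
    u = v := by
  rcases prefix_or_prefix_of_mem h₁ h₂ with h | h
  · exact eq_of_mem_stoppingWords_of_prefix hu hv h
  · exact (eq_of_mem_stoppingWords_of_prefix hv hu h).symm

/-- Deleting the last digit gives a rate above `r`, and that digit costs a factor of at least `m`.
The empty word needs `r ≤ 1`. -/
theorem mul_le_of_mem_stoppingWords {m : ℝ} (hm0 : 0 < m) (hm1 : m < 1)
    (hm : ∀ i, m ≤ F.ratio i) (hr1 : r ≤ 1) (hu : u ∈ F.stoppingWords r) :
    m * r ≤ F.wordRatio u := by
  rcases List.eq_nil_or_concat u with rfl | ⟨v, i, rfl⟩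
  · rw [wordRatio_nil]; nlinarith
  · have := hu.2 v (by simp) (by simp)
    simp only [List.concat_eq_append]
    rw [wordRatio_append]
    have h1 : F.wordRatio [i] = F.ratio i := by simp [wordRatio]
    rw [h1, mul_comm]
    exact mul_le_mul this.le (hm i) hm0.le (F.wordRatio_pos v).le

theorem length_le_of_mem_stoppingWords {m : ℝ} (hm0 : 0 < m) (hm1 : m < 1)
    (hm : ∀ i, m ≤ F.ratio i) {n : ℕ} (hr : r ≤ m ^ n) (hu : u ∈ F.stoppingWords r) :
    n ≤ u.length :=
  (pow_le_pow_iff_right_of_lt_one₀ hm0 hm1).1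
    (((pow_length_le_wordRatio hm0 hm u).trans hu.1).trans hr)

end stopping

/-! ### Extending rectangles to orientation preserving squares. -/

section balanced

/-- Dirichlet's approximation theorem for `x / y`. The multiple of `x` is positive because it will
count copies of a word of which one is already present. -/
theorem exists_nat_mul_sub_nat_mul_lt {x y δ : ℝ} (hx : 0 ≤ x) (hy : 0 < y) (hδ : 0 < δ) :
    ∃ q l : ℕ, |(q + 1) * x - l * y| < δ := by
  obtain ⟨n, hn⟩ := exists_nat_gt (y / δ)
  have hn0 : (0 : ℝ) < n := lt_trans (by positivity) hn
  obtain ⟨k, hk0, -, hk⟩ := Real.exists_nat_abs_mul_sub_round_le (x / y) (n := n)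
    (by exact_mod_cast hn0)
  obtain ⟨q, rfl⟩ := Nat.exists_eq_succ_of_ne_zero hk0.ne'
  have hround : 0 ≤ round (((q.succ : ℕ) : ℝ) * (x / y)) := by
    rw [round_eq]
    exact Int.floor_nonneg.2 (by positivity)
  obtain ⟨l, hl⟩ := Int.eq_ofNat_of_zero_le hround
  refine ⟨q, l, ?_⟩
  rw [hl] at hk
  have e : ((q : ℝ) + 1) * x - l * y = y * (((q.succ : ℕ) : ℝ) * (x / y) - ((l : ℤ) : ℝ)) := by
    push_cast
    field_simp
  rw [e, abs_mul, abs_of_pos hy]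
  refine (mul_le_mul_of_nonneg_left hk hy.le).trans_lt ?_
  rw [mul_one_div, div_lt_iff₀ (by positivity)]
  rw [div_lt_iff₀ hδ] at hn
  nlinarith

theorem wordRatio_power (F : AffineIFS A) (u : List (Fin A)) (n : ℕ) :
    F.wordRatio (List.replicate n u).flatten = F.wordRatio u ^ n := by
  induction n with
  | zero => simp
  | succ n ih => rw [List.replicate_succ, List.flatten_cons, wordRatio_append, ih, pow_succ']

theorem wordSign_power (F : AffineIFS A) (u : List (Fin A)) (n : ℕ) :
    F.wordSign (List.replicate n u).flatten = F.wordSign u ^ n := by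
  induction n with
  | zero => simp
  | succ n ih => rw [List.replicate_succ, List.flatten_cons, wordSign_append, ih, pow_succ']

theorem wordSign_pow_even (F : AffineIFS A) (u : List (Fin A)) (n : ℕ) :
    F.wordSign u ^ (2 * n) = 1 := by
  rw [pow_mul, pow_two, wordSign_mul_self, one_pow]

/-- The logarithm of the ratio of the contraction rates of a pair of words. -/
noncomputable def logRatio (F : AffineIFS A) (G : AffineIFS B)
    (w : List (Fin A) × List (Fin B)) : ℝ :=
  Real.log (F.wordRatio w.1) - Real.log (G.wordRatio w.2)

theorem logRatio_pairAppend (F : AffineIFS A) (G : AffineIFS B)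
    (w w' : List (Fin A) × List (Fin B)) :
    logRatio F G (pairAppend w w') = logRatio F G w + logRatio F G w' := by
  simp only [logRatio, pairAppend, wordRatio_append]
  rw [Real.log_mul (F.wordRatio_pos _).ne' (F.wordRatio_pos _).ne',
    Real.log_mul (G.wordRatio_pos _).ne' (G.wordRatio_pos _).ne']
  ring

theorem exp_logRatio (F : AffineIFS A) (G : AffineIFS B) (w : List (Fin A) × List (Fin B)) :
    Real.exp (logRatio F G w) = F.wordRatio w.1 / G.wordRatio w.2 := by
  rw [logRatio, Real.exp_sub, Real.exp_log (F.wordRatio_pos _), Real.exp_log (G.wordRatio_pos _)]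

theorem isDeltaSquare_iff (F : AffineIFS A) (G : AffineIFS B) {δ : ℝ}
    (w : List (Fin A) × List (Fin B)) : F.IsDeltaSquare G δ w ↔ |logRatio F G w| < δ := by
  rw [IsDeltaSquare, ← exp_logRatio, Set.mem_Ioo, Real.exp_lt_exp, Real.exp_lt_exp, abs_lt]

/-- Repeating `w` multiplies its logarithmic eccentricity, and copies of the digit `0` on the first
side bring it back almost to zero, by Dirichlet. Even total numbers of copies make both orientations
positive. -/
theorem exists_balanced_extension_of_nonneg [NeZero A] (F : AffineIFS A) (G : AffineIFS B)
    (w : List (Fin A) × List (Fin B)) {δ : ℝ} (hδ : 0 < δ) (hw : 0 ≤ logRatio F G w) :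
    ∃ e, F.wordSign (w.1 ++ e.1) = 1 ∧ G.wordSign (w.2 ++ e.2) = 1 ∧
      |logRatio F G (pairAppend w e)| < δ := by
  obtain ⟨q, l, h⟩ := exists_nat_mul_sub_nat_mul_lt hw
    (neg_pos.2 (Real.log_neg (F.wordRatio_pos [0])
      (by simpa [wordRatio] using F.ratio_lt_one 0))) (half_pos hδ)
  refine ⟨((List.replicate (2 * q + 1) w.1).flatten ++ (List.replicate (2 * l) [0]).flatten,
    (List.replicate (2 * q + 1) w.2).flatten), ?_, ?_, ?_⟩
  · rw [wordSign_append, wordSign_append, wordSign_power, wordSign_power, wordSign_pow_even,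
      mul_one, ← pow_succ', show 2 * q + 1 + 1 = 2 * (q + 1) by ring, wordSign_pow_even]
  · rw [wordSign_append, wordSign_power, ← pow_succ', show 2 * q + 1 + 1 = 2 * (q + 1) by ring,
      wordSign_pow_even]
  · rw [logRatio_pairAppend]
    have : logRatio F G w + logRatio F G ((List.replicate (2 * q + 1) w.1).flatten ++
        (List.replicate (2 * l) [0]).flatten, (List.replicate (2 * q + 1) w.2).flatten)
        = 2 * ((q + 1) * logRatio F G w - l * -Real.log (F.wordRatio [0])) := by
      simp only [logRatio, wordRatio_append, wordRatio_power]
      rw [Real.log_mul (pow_pos (F.wordRatio_pos _) _).ne' (pow_pos (F.wordRatio_pos _) _).ne',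
        Real.log_pow, Real.log_pow, Real.log_pow]
      push_cast
      ring
    rw [this, abs_mul, abs_two]
    linarith

theorem exists_balanced_extension [NeZero A] [NeZero B] (F : AffineIFS A) (G : AffineIFS B)
    (w : List (Fin A) × List (Fin B)) {δ : ℝ} (hδ : 0 < δ) :
    ∃ e, F.wordSign (w.1 ++ e.1) = 1 ∧ G.wordSign (w.2 ++ e.2) = 1 ∧
      |logRatio F G (pairAppend w e)| < δ := by
  rcases le_total 0 (logRatio F G w) with h | h
  · exact exists_balanced_extension_of_nonneg F G w hδ h
  · obtain ⟨e, h₁, h₂, h₃⟩ := exists_balanced_extension_of_nonneg G F w.swap hδ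
      (by simp only [logRatio, Prod.fst_swap, Prod.snd_swap] at h ⊢; linarith)
    refine ⟨e.swap, h₂, h₁, ?_⟩
    rw [logRatio, abs_sub_comm] at h₃
    exact h₃

/-- Every pair of words of bounded ratio has an orientation preserving extension that is almost a
square, with extending words of contraction rate bounded from below. -/
theorem exists_uniform_balanced_extension [NeZero A] [NeZero B] (F : AffineIFS A)
    (G : AffineIFS B) {δ : ℝ} (hδ : 0 < δ) (T : ℝ) :
    ∃ κ > 0, ∀ w, |logRatio F G w| ≤ T →
      ∃ e, F.wordSign (w.1 ++ e.1) = 1 ∧ G.wordSign (w.2 ++ e.2) = 1 ∧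
        |logRatio F G (pairAppend w e)| < δ ∧ κ ≤ F.wordRatio e.1 ∧ κ ≤ G.wordRatio e.2 := by
  classical
  -- An extension changes `logRatio` by a fixed summand and the orientations by fixed factors. So
  -- one that balances a representative within `δ / 2` balances its whole class within `δ`, and only
  -- finitely many classes occur.
  let f : List (Fin A) × List (Fin B) → ℤ × ℝ × ℝ := fun w =>
    (⌊logRatio F G w / (δ / 2)⌋, F.wordSign w.1, G.wordSign w.2)
  let S : Set (List (Fin A) × List (Fin B)) := {w | |logRatio F G w| ≤ T}
  have hfin : (f '' S).Finite := by
    refine Set.Finite.subset (((Set.finite_Icc ⌊-T / (δ / 2)⌋ ⌊T / (δ / 2)⌋).prod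
      ((Set.toFinite {(1 : ℝ), -1}).prod (Set.toFinite {(1 : ℝ), -1})))) ?_
    rintro _ ⟨w, hw, rfl⟩
    have hw' := abs_le.1 (show |logRatio F G w| ≤ T from hw)
    refine ⟨⟨Int.floor_le_floor ?_, Int.floor_le_floor ?_⟩, ?_, ?_⟩
    · exact div_le_div_of_nonneg_right hw'.1 (by positivity)
    · exact div_le_div_of_nonneg_right hw'.2 (by positivity)
    · simpa using F.wordSign_eq w.1
    · simpa using G.wordSign_eq w.2
  have hext : ∀ c ∈ f '' S, ∃ κ > 0, ∀ w, f w = c →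
      ∃ e, F.wordSign (w.1 ++ e.1) = 1 ∧ G.wordSign (w.2 ++ e.2) = 1 ∧
        |logRatio F G (pairAppend w e)| < δ ∧ κ ≤ F.wordRatio e.1 ∧ κ ≤ G.wordRatio e.2 := by
    rintro _ ⟨w₀, -, rfl⟩
    obtain ⟨e, h₁, h₂, h₃⟩ := exists_balanced_extension F G w₀ (half_pos hδ)
    refine ⟨min (F.wordRatio e.1) (G.wordRatio e.2),
      lt_min (F.wordRatio_pos _) (G.wordRatio_pos _), fun w hw => ⟨e, ?_, ?_, ?_,
        min_le_left _ _, min_le_right _ _⟩⟩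
    · have : F.wordSign w.1 = F.wordSign w₀.1 := congrArg (fun c => c.2.1) hw
      rw [wordSign_append, this, ← wordSign_append, h₁]
    · have : G.wordSign w.2 = G.wordSign w₀.2 := congrArg (fun c => c.2.2) hw
      rw [wordSign_append, this, ← wordSign_append, h₂]
    · have h : |logRatio F G w / (δ / 2) - logRatio F G w₀ / (δ / 2)| < 1 :=
        Int.abs_sub_lt_one_of_floor_eq_floor (congrArg (fun c => c.1) hw)
      rw [← sub_div, abs_div, abs_of_pos (half_pos hδ), div_lt_one (half_pos hδ)] at h
      rw [logRatio_pairAppend] at h₃ ⊢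
      rw [abs_lt] at h h₃ ⊢
      constructor <;> linarith [h.1, h.2, h₃.1, h₃.2]
  choose! k hk0 hk using hext
  obtain ⟨κ, hκ0, hκ⟩ : ∃ κ > 0, ∀ c ∈ f '' S, κ ≤ k c := by
    rcases (f '' S).eq_empty_or_nonempty with he | hne
    · exact ⟨1, one_pos, by simp [he]⟩
    · obtain ⟨c, hc, hmin⟩ := hfin.exists_minimalFor k _ hne
      exact ⟨k c, hk0 c hc, fun c' hc' => (le_total (k c') (k c)).elim (hmin hc') id⟩
  refine ⟨κ, hκ0, fun w hw => ?_⟩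
  have hc : f w ∈ f '' S := ⟨w, hw, rfl⟩
  obtain ⟨e, h₁, h₂, h₃, h₄, h₅⟩ := hk _ hc w rfl
  exact ⟨e, h₁, h₂, h₃, (hκ _ hc).trans h₄, (hκ _ hc).trans h₅⟩

end balanced

/-! ### Bernoulli measures and the similarity dimension. -/

section measure

open MeasureTheory

/-- The defining equation of `d` says that the weights `ratio i ^ d` form a probability vector; the
measure is the law of independent digits with these weights. -/
theorem exists_bernoulli (F : AffineIFS A) {d : ℝ} (hd : F.IsSimilarityDim d) :
    ∃ μ : Measure (ℕ → Fin A), IsProbabilityMeasure μ ∧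
      ∀ u, μ (cylinder u) = ENNReal.ofReal (F.wordRatio u ^ d) := by
  have hnn : ∀ i, 0 ≤ F.ratio i ^ d := fun i => Real.rpow_nonneg (F.ratio_pos i).le d
  let p : PMF (Fin A) := PMF.ofFintype (fun i => ENNReal.ofReal (F.ratio i ^ d)) (by
    rw [← ENNReal.ofReal_sum_of_nonneg fun i _ => hnn i, show ∑ i, F.ratio i ^ d = 1 from hd,
      ENNReal.ofReal_one])
  have hp : ∀ i, p.toMeasure {i} = ENNReal.ofReal (F.ratio i ^ d) := fun i => by
    rw [PMF.toMeasure_apply_singleton _ _ (measurableSet_singleton i)]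
    rfl
  refine ⟨Measure.infinitePi fun _ => p.toMeasure, inferInstance, fun u => ?_⟩
  rcases Nat.eq_zero_or_pos A with rfl | hA
  · exact absurd hd (by simp [IsSimilarityDim])
  have : NeZero A := ⟨hA.ne'⟩
  have hcyl : cylinder u = Set.pi (Finset.range u.length) fun i => {u.getD i 0} := by
    ext ω
    simp only [cylinder, Set.mem_ofPred_eq, digits, Set.mem_pi, Finset.coe_range, Set.mem_Iio,
      Set.mem_singleton_iff]
    constructor
    · intro h i hi
      have := congrArg (fun l : List (Fin A) => l.getD i 0) h
      simpa [hi] using this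
    · intro h
      refine List.ext_getElem (by simp) fun i h₁ h₂ => ?_
      simpa [h₂] using h i h₂
  rw [hcyl, Measure.infinitePi_pi _ (fun i _ => measurableSet_singleton _)]
  simp only [hp]
  rw [← ENNReal.ofReal_prod_of_nonneg fun i _ => hnn _, Real.finsetProd_rpow _ _
    fun i _ => (F.ratio_pos _).le]
  congr 2
  have hmap : (List.range u.length).map (fun i => F.ratio (u.getD i 0)) = u.map F.ratio := by
    refine List.ext_getElem (by simp) fun i h₁ h₂ => ?_
    have : i < u.length := by simpa using h₂
    simp [this]
  rw [wordRatio, ← hmap]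
  rfl

theorem exists_product_bernoulli (F : AffineIFS A) (G : AffineIFS B) {d₁ d₂ : ℝ}
    (hd₁ : F.IsSimilarityDim d₁) (hd₂ : G.IsSimilarityDim d₂) :
    ∃ μ : Measure ((ℕ → Fin A) × (ℕ → Fin B)), IsProbabilityMeasure μ ∧
      ∀ w, μ (rect w) = ENNReal.ofReal (F.wordRatio w.1 ^ d₁ * G.wordRatio w.2 ^ d₂) := by
  obtain ⟨μ, hμ, h⟩ := F.exists_bernoulli hd₁
  obtain ⟨ν, hν, h'⟩ := G.exists_bernoulli hd₂
  refine ⟨μ.prod ν, inferInstance, fun w => ?_⟩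
  rw [rect, Measure.prod_prod, h, h', ENNReal.ofReal_mul (by
    exact Real.rpow_nonneg (F.wordRatio_pos _).le _)]

theorem IsSimilarityDim.nonneg [NeZero A] {F : AffineIFS A} {d : ℝ} (h : F.IsSimilarityDim d) :
    0 ≤ d := by
  by_contra! hd
  have h1 : F.ratio 0 ^ d ≤ ∑ i, F.ratio i ^ d :=
    Finset.single_le_sum (f := fun i => F.ratio i ^ d)
      (fun i _ => Real.rpow_nonneg (F.ratio_pos i).le d) (Finset.mem_univ 0)
  rw [show ∑ i, F.ratio i ^ d = 1 from h] at h1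
  exact absurd h1 (not_le.2 (Real.one_lt_rpow_of_pos_of_lt_one_of_neg (F.ratio_pos 0)
    (F.ratio_lt_one 0) hd))

/-- Dimension zero forces a single map, hence a single code and a one-point attractor. -/
theorem IsSimilarityDim.pos [NeZero A] {F : AffineIFS A} {d : ℝ} (h : F.IsSimilarityDim d)
    {C : Set ℝ} (hC : F.IsAttractor C) (hne : C.Nontrivial) : 0 < d := by
  refine lt_of_le_of_ne h.nonneg fun hd => ?_
  subst hd
  have hA : A = 1 := by
    have : (A : ℝ) = 1 := by simpa [IsSimilarityDim] using h
    exact_mod_cast this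
  subst hA
  obtain ⟨x, hx, y, hy, hxy⟩ := hne
  obtain ⟨ω, rfl⟩ := hC.exists_proj_eq hx
  obtain ⟨τ, rfl⟩ := hC.exists_proj_eq hy
  exact hxy (by rw [Subsingleton.elim ω τ])

end measure

/-! ### Without close squares the Hausdorff measure is positive. -/

section packing

open MeasureTheory

theorem abs_sumProj_sub_le {F : AffineIFS A} {G : AffineIFS B} {X Y : ℝ}
    (hX : ∀ ω, |F.proj ω| ≤ X) (hY : ∀ τ, |G.proj τ| ≤ Y)
    {w : List (Fin A) × List (Fin B)} {x y : (ℕ → Fin A) × (ℕ → Fin B)} (hx : x ∈ rect w)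
    (hy : y ∈ rect w) :
    |sumProj F G x.1 x.2 - sumProj F G y.1 y.2| ≤
      F.wordRatio w.1 * (2 * X) + G.wordRatio w.2 * (2 * Y) := by
  rw [sumProj, sumProj, F.proj_eq_of_mem_cylinder hx.1, F.proj_eq_of_mem_cylinder hy.1,
    G.proj_eq_of_mem_cylinder hx.2, G.proj_eq_of_mem_cylinder hy.2, add_sub_add_comm,
    wordMap_sub, wordMap_sub]
  refine (abs_add_le _ _).trans (add_le_add ?_ ?_)
  · rw [abs_mul, abs_mul, abs_wordSign, one_mul, abs_of_pos (F.wordRatio_pos _)]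
    refine mul_le_mul_of_nonneg_left ((abs_sub _ _).trans ?_) (F.wordRatio_pos _).le
    rw [two_mul]
    exact add_le_add (hX _) (hX _)
  · rw [abs_mul, abs_mul, abs_wordSign, one_mul, abs_of_pos (G.wordRatio_pos _)]
    refine mul_le_mul_of_nonneg_left ((abs_sub _ _).trans ?_) (G.wordRatio_pos _).le
    rw [two_mul]
    exact add_le_add (hY _) (hY _)

theorem logRatio_le_of_mem_Icc {F : AffineIFS A} {G : AffineIFS B} {m r : ℝ} (hm : 0 < m)
    (hr : 0 < r) {w : List (Fin A) × List (Fin B)}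
    (h₁ : F.wordRatio w.1 ∈ Set.Icc (m * r) r) (h₂ : G.wordRatio w.2 ∈ Set.Icc (m * r) r) :
    |logRatio F G w| ≤ -Real.log m := by
  have l : ∀ t ∈ Set.Icc (m * r) r, Real.log m + Real.log r ≤ Real.log t ∧
      Real.log t ≤ Real.log r := fun t ht => by
    rw [← Real.log_mul hm.ne' hr.ne']
    have : 0 < m * r := by positivity
    exact ⟨Real.log_le_log this ht.1, Real.log_le_log (this.trans_le ht.1) ht.2⟩
  obtain ⟨a, b⟩ := l _ h₁
  obtain ⟨c, d⟩ := l _ h₂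
  rw [logRatio, abs_le]
  constructor <;> linarith

theorem div_mem_Ioo_exp {a b ε r : ℝ} (ha : 0 < a) (hb : 0 < b) (hε : 0 < ε)
    (h : ⌊(Real.log a - Real.log r) / ε⌋ = ⌊(Real.log b - Real.log r) / ε⌋) :
    a / b ∈ Set.Ioo (Real.exp (-ε)) (Real.exp ε) := by
  have h := Int.abs_sub_lt_one_of_floor_eq_floor h
  rw [← sub_div, sub_sub_sub_cancel_right, abs_div, abs_of_pos hε, div_lt_one hε, abs_lt] at h
  rw [← Real.exp_log ha, ← Real.exp_log hb, ← Real.exp_sub, Set.mem_Ioo, Real.exp_lt_exp,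
    Real.exp_lt_exp]
  exact h

/-- No stopping word is a proper prefix of another, so a stopping pair can be read off from any
extension. Distinct rectangles thus have distinct squares inside them. -/
theorem pair_eq_of_append_eq {F : AffineIFS A} {G : AffineIFS B} {r : ℝ}
    {w w' e e' : List (Fin A) × List (Fin B)}
    (h₁ : w.1 ∈ F.stoppingWords r) (h₂ : w.2 ∈ G.stoppingWords r)
    (h₁' : w'.1 ∈ F.stoppingWords r) (h₂' : w'.2 ∈ G.stoppingWords r)
    (h : pairAppend w e = pairAppend w' e') : w = w' := by
  have key : ∀ {n : ℕ} {H : AffineIFS n} {u u' t t' : List (Fin n)}, u ∈ H.stoppingWords r →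
      u' ∈ H.stoppingWords r → u ++ t = u' ++ t' → u = u' := by
    intro n H u u' t t' hu hu' h
    rcases List.prefix_or_prefix_of_prefix (List.prefix_append u t)
      (h ▸ List.prefix_append u' t') with h | h
    · exact eq_of_mem_stoppingWords_of_prefix hu hu' h
    · exact (eq_of_mem_stoppingWords_of_prefix hu' hu h).symm
  exact Prod.ext (key h₁ h₁' (congrArg Prod.fst h)) (key h₂ h₂' (congrArg Prod.snd h))

/-- If there are no relatively close squares, then boundedly many rectangles of size `r` meet a
given set of diameter at most `r`. -/
theorem exists_packing_bound [NeZero A] [NeZero B] {F : AffineIFS A} {G : AffineIFS B} {X Y : ℝ}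
    (hX : ∀ ω, |F.proj ω| ≤ X) (hY : ∀ τ, |G.proj τ| ≤ Y) {m : ℝ} (hm0 : 0 < m) (hm1 : m < 1)
    (hmF : ∀ i, m ≤ F.ratio i) (hmG : ∀ i, m ≤ G.ratio i) {D ε : ℝ} (hD : 0 < D) (hε : 0 < ε)
    (h : ∀ w₁ w₂ : List (Fin A) × List (Fin B), w₁ ≠ w₂ → F.IsDeltaSquare G ε w₁ →
      F.IsDeltaSquare G ε w₂ → ¬ F.RelativelyClose G D ε w₁ w₂) :
    ∃ N : ℕ, ∀ (r x₀ : ℝ), 0 < r → r ≤ 1 → ∃ T : Finset (List (Fin A) × List (Fin B)),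
      T.card ≤ N ∧ ∀ w, w.1 ∈ F.stoppingWords r → w.2 ∈ G.stoppingWords r →
        (∃ x ∈ rect w, |sumProj F G x.1 x.2 - x₀| ≤ r) → w ∈ T := by
  classical
  obtain ⟨κ, hκ0, hκ⟩ := exists_uniform_balanced_extension F G hε (-Real.log m)
  choose! e he₁ he₂ he₃ he₄ he₅ using hκ
  -- All rates of the extended words are at least `κ * m * r`, so positions in the same cell of
  -- length `η * r` satisfy the third condition of relative closeness.
  let η : ℝ := ε * D * (κ * m)
  have hη : 0 < η := by positivity
  -- The possible values of the two rates, the two orientations and the position after rescaling by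
  -- `r`: a finite set that depends on neither `r` nor `x₀`.
  let Q : Finset (ℤ × ℤ × ℝ × ℝ × ℤ) :=
    Finset.Icc ⌊Real.log (κ * m) / ε⌋ 0 ×ˢ Finset.Icc ⌊Real.log (κ * m) / ε⌋ 0 ×ˢ
      {1, -1} ×ˢ {1, -1} ×ˢ Finset.Icc ⌊-(2 * X + 2 * Y + 1) / η⌋ ⌊(2 * X + 2 * Y + 1) / η⌋
  refine ⟨Q.card, fun r x₀ hr0 hr1 => ?_⟩
  let S : Set (List (Fin A) × List (Fin B)) := {w | w.1 ∈ F.stoppingWords r ∧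
    w.2 ∈ G.stoppingWords r ∧ ∃ x ∈ rect w, |sumProj F G x.1 x.2 - x₀| ≤ r}
  let L : List (Fin A) × List (Fin B) → ℝ := fun w => sumProj F G (extend w.1) (extend w.2)
  let f : List (Fin A) × List (Fin B) → ℤ × ℤ × ℝ × ℝ × ℤ := fun w =>
    let p := pairAppend w (e w)
    (⌊(Real.log (F.wordRatio p.1) - Real.log r) / ε⌋,
      ⌊(Real.log (G.wordRatio p.2) - Real.log r) / ε⌋, F.wordSign p.1, G.wordSign p.2,
      ⌊(L p - x₀) / (η * r)⌋)
  have hX0 : 0 ≤ X := (abs_nonneg _).trans (hX fun _ => 0)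
  have hY0 : 0 ≤ Y := (abs_nonneg _).trans (hY fun _ => 0)
  have hF : ∀ w ∈ S, F.wordRatio w.1 ∈ Set.Icc (m * r) r := fun w hw =>
    ⟨mul_le_of_mem_stoppingWords hm0 hm1 hmF hr1 hw.1, hw.1.1⟩
  have hG : ∀ w ∈ S, G.wordRatio w.2 ∈ Set.Icc (m * r) r := fun w hw =>
    ⟨mul_le_of_mem_stoppingWords hm0 hm1 hmG hr1 hw.2.1, hw.2.1.1⟩
  have hlog : ∀ w ∈ S, |logRatio F G w| ≤ -Real.log m := fun w hw =>
    logRatio_le_of_mem_Icc hm0 hr0 (hF w hw) (hG w hw)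
  have hpF : ∀ w ∈ S, F.wordRatio (pairAppend w (e w)).1 ∈ Set.Icc (κ * m * r) r := by
    intro w hw
    simp only [pairAppend, wordRatio_append]
    constructor
    · rw [mul_assoc, mul_comm κ]
      exact mul_le_mul (hF w hw).1 (he₄ w (hlog w hw)) hκ0.le (F.wordRatio_pos _).le
    · exact (mul_le_of_le_one_right (F.wordRatio_pos _).le (F.wordRatio_le_one _)).trans
        (hF w hw).2
  have hpG : ∀ w ∈ S, G.wordRatio (pairAppend w (e w)).2 ∈ Set.Icc (κ * m * r) r := by
    intro w hw
    simp only [pairAppend, wordRatio_append]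
    constructor
    · rw [mul_assoc, mul_comm κ]
      exact mul_le_mul (hG w hw).1 (he₅ w (hlog w hw)) hκ0.le (G.wordRatio_pos _).le
    · exact (mul_le_of_le_one_right (G.wordRatio_pos _).le (G.wordRatio_le_one _)).trans
        (hG w hw).2
  have hfloor : ∀ t ∈ Set.Icc (κ * m * r) r,
      ⌊(Real.log t - Real.log r) / ε⌋ ∈ Finset.Icc ⌊Real.log (κ * m) / ε⌋ 0 := by
    intro t ht
    have h0 : 0 < κ * m * r := by positivity
    have h₁ := Real.log_le_log h0 ht.1
    have h₂ := Real.log_le_log (h0.trans_le ht.1) ht.2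
    rw [Real.log_mul (by positivity) hr0.ne'] at h₁
    refine Finset.mem_Icc.2 ⟨Int.floor_le_floor (div_le_div_of_nonneg_right (by linarith) hε.le),
      ?_⟩
    refine Int.floor_nonpos (div_nonpos_of_nonpos_of_nonneg (by linarith) hε.le)
  have hmaps : Set.MapsTo f S Q := by
    intro w hw
    obtain ⟨x, hx, hxs⟩ := hw.2.2
    have hext : (extend (pairAppend w (e w)).1, extend (pairAppend w (e w)).2) ∈ rect w :=
      rect_append_subset w (e w) ⟨extend_mem_cylinder _, extend_mem_cylinder _⟩
    have h1 := abs_sumProj_sub_le hX hY hext hx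
    have h2 : |L (pairAppend w (e w)) - x₀| ≤ (2 * X + 2 * Y + 1) * r := by
      have h3 := mul_le_mul_of_nonneg_right (hF w hw).2 (by linarith : 0 ≤ 2 * X)
      have h4 := mul_le_mul_of_nonneg_right (hG w hw).2 (by linarith : 0 ≤ 2 * Y)
      have h5 := abs_sub_le (L (pairAppend w (e w))) (sumProj F G x.1 x.2) x₀
      have h6 : |L (pairAppend w (e w)) - sumProj F G x.1 x.2| ≤ _ := h1
      linarith
    rw [abs_le] at h2
    simp only [Q, f, Finset.coe_product, Set.mem_prod, Finset.mem_coe]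
    refine ⟨hfloor _ (hpF w hw), hfloor _ (hpG w hw), ?_, ?_, Finset.mem_Icc.2
      ⟨Int.floor_le_floor ?_, Int.floor_le_floor ?_⟩⟩
    · simpa using F.wordSign_eq _
    · simpa using G.wordSign_eq _
    · rw [div_le_div_iff₀ hη (by positivity)]
      nlinarith [mul_le_mul_of_nonneg_right h2.1 hη.le]
    · rw [div_le_div_iff₀ (by positivity) hη]
      nlinarith [mul_le_mul_of_nonneg_right h2.2 hη.le]
  -- Two rectangles with equal data would contain distinct relatively close squares.
  have hinj : Set.InjOn f S := by
    intro w hw w' hw' hff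
    by_contra hne
    refine h (pairAppend w (e w)) (pairAppend w' (e w'))
      (fun h' => hne (pair_eq_of_append_eq hw.1 hw.2.1 hw'.1 hw'.2.1 h'))
      ((isDeltaSquare_iff F G _).2 (he₃ w (hlog w hw)))
      ((isDeltaSquare_iff F G _).2 (he₃ w' (hlog w' hw')))
      ⟨⟨div_mem_Ioo_exp (F.wordRatio_pos _) (F.wordRatio_pos _) hε (congrArg (fun c => c.1) hff),
        div_mem_Ioo_exp (G.wordRatio_pos _) (G.wordRatio_pos _) hε
          (congrArg (fun c => c.2.1) hff)⟩,
        ⟨congrArg (fun c => c.2.2.1) hff, congrArg (fun c => c.2.2.2.1) hff⟩, ?_⟩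
    have h1 := Int.abs_sub_lt_one_of_floor_eq_floor (congrArg (fun c => c.2.2.2.2) hff)
    rw [← sub_div, sub_sub_sub_cancel_right, abs_div, abs_of_pos (by positivity : 0 < η * r),
      div_lt_one (by positivity)] at h1
    refine h1.trans_le ?_
    rw [show η * r = ε * D * (κ * m * r) by simp only [η]; ring]
    exact mul_le_mul_of_nonneg_left (le_min (le_min (hpF w hw).1 (hpF w' hw').1)
      (le_min (hpG w hw).1 (hpG w' hw').1)) (by positivity)
  have hfin : S.Finite := Set.Finite.of_finite_image
    (Q.finite_toSet.subset hmaps.image_subset) hinj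
  refine ⟨hfin.toFinset, Finset.card_le_card_of_injOn f (by simpa using hmaps)
    (by simpa using hinj), fun w h₁ h₂ h₃ => hfin.mem_toFinset.2 ⟨h₁, h₂, h₃⟩⟩

theorem measurable_sumProj (F : AffineIFS A) (G : AffineIFS B) :
    Measurable fun x : (ℕ → Fin A) × (ℕ → Fin B) => sumProj F G x.1 x.2 :=
  ((measurable_proj F).comp measurable_fst).add ((measurable_proj G).comp measurable_snd)

/-- The mass distribution principle for the image `ν` of the Bernoulli product: at most `N` stopping
rectangles, each of mass at most `r ^ (d₁ + d₂)`, project into a set of diameter `r`. -/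
theorem hausdorffMeasure_pos_of_packing_bound [NeZero A] [NeZero B] {F : AffineIFS A}
    {G : AffineIFS B} {C₁ C₂ : Set ℝ} (hC₁ : F.IsAttractor C₁) (hC₂ : G.IsAttractor C₂)
    {d₁ d₂ : ℝ} (hd₁ : F.IsSimilarityDim d₁) (hd₂ : G.IsSimilarityDim d₂)
    {N : ℕ} (hN : ∀ (r x₀ : ℝ), 0 < r → r ≤ 1 → ∃ T : Finset (List (Fin A) × List (Fin B)),
      T.card ≤ N ∧ ∀ w, w.1 ∈ F.stoppingWords r → w.2 ∈ G.stoppingWords r →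
        (∃ x ∈ rect w, |sumProj F G x.1 x.2 - x₀| ≤ r) → w ∈ T) :
    0 < Measure.hausdorffMeasure (d₁ + d₂) (C₁ + C₂) := by
  classical
  obtain ⟨μ, hμ, hrect⟩ := exists_product_bernoulli F G hd₁ hd₂
  let ν := μ.map fun x => sumProj F G x.1 x.2
  have hmeas := measurable_sumProj F G
  have hν : IsProbabilityMeasure ν := Measure.isProbabilityMeasure_map hmeas.aemeasurable
  have bound : ∀ (s : Set ℝ) (r : ℝ), 0 < r → r ≤ 1 → Metric.ediam s ≤ ENNReal.ofReal r →
      ν s ≤ N * ENNReal.ofReal r ^ (d₁ + d₂) := by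
    intro s r hr0 hr1 hs
    rcases s.eq_empty_or_nonempty with rfl | ⟨x₀, hx₀⟩
    · simp
    obtain ⟨T, hT, hTmem⟩ := hN r x₀ hr0 hr1
    have hsub : s ⊆ Metric.closedBall x₀ r := fun y hy => by
      have := (Metric.edist_le_ediam_of_mem hy hx₀).trans hs
      rw [edist_dist] at this
      exact (ENNReal.ofReal_le_ofReal_iff hr0.le).1 this
    have hpre : (fun x : (ℕ → Fin A) × (ℕ → Fin B) => sumProj F G x.1 x.2) ⁻¹'
        Metric.closedBall x₀ r ⊆ ⋃ w ∈ T.filter fun w => w.1 ∈ F.stoppingWords r ∧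
          w.2 ∈ G.stoppingWords r, rect w := by
      intro x hx
      obtain ⟨u, hu, hxu⟩ := F.exists_mem_stoppingWords hr0 x.1
      obtain ⟨v, hv, hxv⟩ := G.exists_mem_stoppingWords hr0 x.2
      refine Set.mem_biUnion (x := (u, v)) (Finset.mem_coe.2 (Finset.mem_filter.2
        ⟨hTmem (u, v) hu hv ⟨x, ⟨hxu, hxv⟩, hx⟩, hu, hv⟩)) ⟨hxu, hxv⟩
    calc ν s ≤ ν (Metric.closedBall x₀ r) := measure_mono hsub
      _ = μ _ := Measure.map_apply hmeas Metric.isClosed_closedBall.measurableSet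
      _ ≤ μ _ := measure_mono hpre
      _ ≤ ∑ w ∈ T.filter fun w => w.1 ∈ F.stoppingWords r ∧ w.2 ∈ G.stoppingWords r,
            μ (rect w) := measure_biUnion_finset_le _ _
      _ ≤ ∑ w ∈ T.filter fun w => w.1 ∈ F.stoppingWords r ∧ w.2 ∈ G.stoppingWords r,
            ENNReal.ofReal r ^ (d₁ + d₂) := by
          refine Finset.sum_le_sum fun w hw => ?_
          obtain ⟨-, h₁, h₂⟩ := Finset.mem_filter.1 hw
          rw [hrect, ENNReal.ofReal_rpow_of_pos hr0, Real.rpow_add hr0]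
          exact ENNReal.ofReal_le_ofReal (mul_le_mul
            (Real.rpow_le_rpow (F.wordRatio_pos _).le h₁.1 hd₁.nonneg)
            (Real.rpow_le_rpow (G.wordRatio_pos _).le h₂.1 hd₂.nonneg)
            (Real.rpow_nonneg (G.wordRatio_pos _).le _) (Real.rpow_nonneg hr0.le _))
      _ ≤ N * ENNReal.ofReal r ^ (d₁ + d₂) := by
          rw [Finset.sum_const, nsmul_eq_mul]
          gcongr
          exact (Finset.card_filter_le _ _).trans hT
  have key : ∀ s : Set ℝ, Metric.ediam s ≤ 1 → ν s ≤ N * Metric.ediam s ^ (d₁ + d₂) := by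
    intro s hs
    have htop : Metric.ediam s ≠ ⊤ := ne_top_of_le_ne_top ENNReal.one_ne_top hs
    -- The bound needs a positive scale, so a set of diameter zero is treated by letting the scale
    -- tend to zero.
    rcases eq_or_ne (Metric.ediam s) 0 with h0 | h0
    · have hlim : Filter.Tendsto (fun n : ℕ => (N : ENNReal) *
          ENNReal.ofReal (1 / ((n : ℝ) + 1)) ^ (d₁ + d₂)) Filter.atTop
          (nhds (N * (0 : ENNReal) ^ (d₁ + d₂))) := by
        refine ENNReal.Tendsto.const_mul ?_ (Or.inr (ENNReal.natCast_ne_top N))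
        refine ((ENNReal.continuous_rpow_const (y := d₁ + d₂)).tendsto 0).comp ?_
        simpa using ENNReal.tendsto_ofReal tendsto_one_div_add_atTop_nhds_zero_nat
      rw [h0]
      refine ge_of_tendsto' hlim fun n => bound s _ (by positivity) ?_ (by simp [h0])
      rw [div_le_one (by positivity)]
      linarith [(Nat.cast_nonneg n : (0 : ℝ) ≤ n)]
    · have := bound s (Metric.ediam s).toReal (ENNReal.toReal_pos h0 htop)
        (ENNReal.toReal_mono ENNReal.one_ne_top hs) (ENNReal.ofReal_toReal htop).ge
      rwa [ENNReal.ofReal_toReal htop] at this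
  -- `N + 1` in place of `N` keeps the factor invertible.
  have hle : ((N : ENNReal) + 1)⁻¹ • ν ≤ Measure.hausdorffMeasure (d₁ + d₂) := by
    refine Measure.le_hausdorffMeasure _ _ 1 one_pos fun s hs => ?_
    rw [Measure.smul_apply, smul_eq_mul]
    have hc : (N : ENNReal) + 1 ≠ 0 := by simp
    have hc' : (N : ENNReal) + 1 ≠ ⊤ := by simp
    rw [ENNReal.inv_mul_le_iff hc hc']
    exact (key s hs).trans (by gcongr; exact le_self_add)
  have hfull : ν (C₁ + C₂) = 1 := by
    rw [Measure.map_apply hmeas (hC₁.2.1.add hC₂.2.1).isClosed.measurableSet]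
    convert! measure_univ (μ := μ)
    exact Set.eq_univ_of_forall fun x => Set.add_mem_add (hC₁.proj_mem _) (hC₂.proj_mem _)
  refine lt_of_lt_of_le ?_ (hle (C₁ + C₂))
  rw [Measure.smul_apply, hfull, smul_eq_mul, mul_one, ENNReal.inv_pos]
  simp

end packing

/-! ### Building large clusters from close squares. -/

section clusters

variable {F : AffineIFS A} {G : AffineIFS B} {ι ι' : Type*}

/-- A family of pairs of words is a cluster if the maps `(x, y) ↦ F_u x + σ G_v y` it
defines are all close to one map `(x, y) ↦ a (x + σ σ' y) + t`, on the scale of `a`. -/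
def IsCluster (F : AffineIFS A) (G : AffineIFS B) (σ σ' η : ℝ)
    (w : ι → List (Fin A) × List (Fin B)) : Prop :=
  ∃ a t : ℝ, a ≠ 0 ∧ ∀ i, |F.wordLin (w i).1 - a| ≤ η * |a| ∧
    |G.wordLin (w i).2 - σ' * a| ≤ η * |a| ∧
    |F.wordMap (w i).1 0 + σ * G.wordMap (w i).2 0 - t| ≤ η * |a|

theorem IsCluster.mono {σ σ' η η' : ℝ} {w : ι → List (Fin A) × List (Fin B)}
    (h : IsCluster F G σ σ' η w) (hη : η ≤ η') : IsCluster F G σ σ' η' w := by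
  obtain ⟨a, t, ha, h⟩ := h
  have := mul_le_mul_of_nonneg_right hη (abs_nonneg a)
  exact ⟨a, t, ha, fun i => ⟨(h i).1.trans this, (h i).2.1.trans this, (h i).2.2.trans this⟩⟩

theorem IsCluster.comp {σ σ' η : ℝ} {w : ι → List (Fin A) × List (Fin B)}
    (h : IsCluster F G σ σ' η w) (f : ι' → ι) : IsCluster F G σ σ' η (w ∘ f) := by
  obtain ⟨a, t, ha, h⟩ := h
  exact ⟨a, t, ha, fun i => h (f i)⟩

theorem abs_mul_sub_mul_le {x y a b η ε : ℝ} (h₁ : |x - a| ≤ η * |a|) (h₂ : |y - b| ≤ ε * |b|) :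
    |x * y - a * b| ≤ (η * (1 + ε) + ε) * (|a| * |b|) := by
  have hy : |y| ≤ (1 + ε) * |b| := by
    have := abs_sub_abs_le_abs_sub y b
    linarith
  calc |x * y - a * b| = |(x - a) * y + a * (y - b)| := by congr 1; ring
    _ ≤ |x - a| * |y| + |a| * |y - b| := by
        refine (abs_add_le _ _).trans_eq ?_
        rw [abs_mul, abs_mul]
    _ ≤ (η * |a|) * ((1 + ε) * |b|) + |a| * (ε * |b|) :=
        add_le_add (mul_le_mul h₁ hy (abs_nonneg _) ((abs_nonneg _).trans h₁))
          (mul_le_mul_of_nonneg_left h₂ (abs_nonneg _))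
    _ = _ := by ring

/-- The concatenation of a sufficiently narrow cluster with a given one is a cluster. -/
theorem IsCluster.exists_append [Fintype ι'] {σ σ' ε : ℝ} (hσ : |σ| = 1) (hσ' : |σ'| = 1)
    (hε0 : 0 < ε) (hε1 : ε ≤ 1) {w' : ι' → List (Fin A) × List (Fin B)}
    (h' : IsCluster F G σ σ' (ε / 4) w') :
    ∃ η > 0, ∀ {ι : Type*} {w : ι → List (Fin A) × List (Fin B)}, IsCluster F G 1 σ η w →
      IsCluster F G 1 (σ * σ') ε fun p : ι × ι' => pairAppend (w p.1) (w' p.2) := by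
  obtain ⟨a', t', ha', h'⟩ := h'
  obtain ⟨P, hP0, hP⟩ : ∃ P : ℝ, 0 ≤ P ∧ ∀ i, |F.wordMap (w' i).1 0| ≤ P ∧
      |G.wordMap (w' i).2 0| ≤ P := by
    refine ⟨∑ i, (|F.wordMap (w' i).1 0| + |G.wordMap (w' i).2 0|),
      Finset.sum_nonneg fun i _ => by positivity, fun i => ?_⟩
    have := Finset.single_le_sum
      (f := fun i => |F.wordMap (w' i).1 0| + |G.wordMap (w' i).2 0|)
      (fun i _ => by positivity) (Finset.mem_univ i)
    constructor <;> linarith [abs_nonneg (F.wordMap (w' i).1 0), abs_nonneg (G.wordMap (w' i).2 0)]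
  have ha0 : 0 < |a'| := abs_pos.2 ha'
  -- The first bound controls the linear parts. The second makes the outer errors, multiplied by the
  -- inner translations, small on the scale `|a * a'|`; hence the outer cluster has to be chosen
  -- after the inner one.
  refine ⟨min (ε / 4) (ε * |a'| / (2 * (2 * P + 1))), by positivity, fun {ι w} h => ?_⟩
  set η := min (ε / 4) (ε * |a'| / (2 * (2 * P + 1))) with hη
  have hη1 : η ≤ ε / 4 := min_le_left _ _
  have hη2 : η * (2 * P + 1) ≤ ε / 2 * |a'| := by
    have := min_le_right (ε / 4) (ε * |a'| / (2 * (2 * P + 1)))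
    rw [← hη, le_div_iff₀ (by positivity)] at this
    linarith
  obtain ⟨a, t, ha, h⟩ := h
  have hcoef : η * (1 + ε / 4) + ε / 4 ≤ ε := by nlinarith
  refine ⟨a * a', a * t' + t, mul_ne_zero ha ha', fun p => ?_⟩
  obtain ⟨h1, h2, h3⟩ := h p.1
  obtain ⟨h1', h2', h3'⟩ := h' p.2
  simp only [pairAppend, wordLin_append, wordMap_append, abs_mul a a']
  have hpos : 0 ≤ |a| * |a'| := by positivity
  refine ⟨?_, ?_, ?_⟩
  · exact (abs_mul_sub_mul_le h1 h1').trans (mul_le_mul_of_nonneg_right hcoef hpos)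
  · have e1 : |σ * a| = |a| := by rw [abs_mul, hσ, one_mul]
    have e2 : |σ' * a'| = |a'| := by rw [abs_mul, hσ', one_mul]
    rw [← e1] at h2
    rw [← e2] at h2'
    have := abs_mul_sub_mul_le h2 h2'
    rw [e1, e2] at this
    rw [show σ * σ' * (a * a') = σ * a * (σ' * a') by ring]
    exact this.trans (mul_le_mul_of_nonneg_right hcoef hpos)
  · rw [F.wordMap_eq (w p.1).1, G.wordMap_eq (w p.1).2]
    obtain ⟨hα, hβ⟩ := hP p.2
    set α := F.wordMap (w' p.2).1 0
    set β := G.wordMap (w' p.2).2 0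
    -- The outer linear parts are close to `a` and `σ * a`, so the inner translations enter as `α +
    -- σ * β`. This is why a cluster carries the weight `σ` on the second translation.
    have e : F.wordLin (w p.1).1 * α + F.wordMap (w p.1).1 0 +
        1 * (G.wordLin (w p.1).2 * β + G.wordMap (w p.1).2 0) - (a * t' + t) =
        ((F.wordLin (w p.1).1 - a) * α + (G.wordLin (w p.1).2 - σ * a) * β) +
        (a * (α + σ * β - t') +
        (F.wordMap (w p.1).1 0 + 1 * G.wordMap (w p.1).2 0 - t)) := by ring
    have m1 : |(F.wordLin (w p.1).1 - a) * α| ≤ η * |a| * P := by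
      rw [abs_mul]; exact mul_le_mul h1 hα (abs_nonneg _) ((abs_nonneg _).trans h1)
    have m2 : |(G.wordLin (w p.1).2 - σ * a) * β| ≤ η * |a| * P := by
      rw [abs_mul]; exact mul_le_mul h2 hβ (abs_nonneg _) ((abs_nonneg _).trans h2)
    have m3 : |a * (α + σ * β - t')| ≤ |a| * (ε / 4 * |a'|) := by
      rw [abs_mul]; exact mul_le_mul_of_nonneg_left h3' (abs_nonneg _)
    rw [e]
    have m4 := mul_le_mul_of_nonneg_left hη2 (abs_nonneg a)
    have m5 := mul_nonneg hε0.le hpos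
    have t1 := abs_add_le ((F.wordLin (w p.1).1 - a) * α + (G.wordLin (w p.1).2 - σ * a) * β)
      (a * (α + σ * β - t') + (F.wordMap (w p.1).1 0 + 1 * G.wordMap (w p.1).2 0 - t))
    have t2 := abs_add_le ((F.wordLin (w p.1).1 - a) * α) ((G.wordLin (w p.1).2 - σ * a) * β)
    have t3 := abs_add_le (a * (α + σ * β - t'))
      (F.wordMap (w p.1).1 0 + 1 * G.wordMap (w p.1).2 0 - t)
    linarith

theorem pairwise_disjoint_rect_append {w : ι → List (Fin A) × List (Fin B)}
    {w' : ι' → List (Fin A) × List (Fin B)}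
    (h : Pairwise fun i j => Disjoint (rect (w i)) (rect (w j)))
    (h' : Pairwise fun i j => Disjoint (rect (w' i)) (rect (w' j))) :
    Pairwise fun p q : ι × ι' => Disjoint (rect (pairAppend (w p.1) (w' p.2)))
      (rect (pairAppend (w q.1) (w' q.2))) := by
  rintro ⟨i, i'⟩ ⟨j, j'⟩ hne
  by_cases hij : i = j
  · subst hij
    exact disjoint_rect_append _ (h' fun h => hne (congrArg (Prod.mk i) h))
  · exact (h hij).mono (rect_append_subset _ _) (rect_append_subset _ _)

theorem abs_sub_le_of_div_mem {x y ε : ℝ} (hy : 0 < y) (hε : ε ≤ 1)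
    (h : x / y ∈ Set.Ioo (Real.exp (-ε)) (Real.exp ε)) : |x - y| ≤ 2 * ε * y := by
  have hpos : 0 < x / y := (Real.exp_pos _).trans h.1
  have hlog : |Real.log (x / y)| < ε := by
    rw [abs_lt, Real.lt_log_iff_exp_lt hpos, Real.log_lt_iff_lt_exp hpos]
    exact h
  have := Real.abs_exp_sub_one_le (hlog.le.trans hε)
  rw [Real.exp_log hpos] at this
  have e : x - y = (x / y - 1) * y := by field_simp
  rw [e, abs_mul, abs_of_pos hy]
  exact mul_le_mul_of_nonneg_right (this.trans (by linarith)) hy.le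

theorem div_mem_Ioo_exp_symm {x y ε : ℝ}
    (h : x / y ∈ Set.Ioo (Real.exp (-ε)) (Real.exp ε)) :
    y / x ∈ Set.Ioo (Real.exp (-ε)) (Real.exp ε) := by
  have hpos : 0 < x / y := (Real.exp_pos _).trans h.1
  rw [← inv_div x y]
  constructor
  · rw [Real.exp_neg]
    exact (inv_lt_inv₀ (Real.exp_pos _) hpos).2 h.2
  · have := (inv_lt_inv₀ hpos (Real.exp_pos _)).2 h.1
    rwa [Real.exp_neg, inv_inv] at this

/-- Any further digit shrinks the rate by a factor at most `M`, which is too much for nearly equal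
rates. -/
theorem eq_of_div_mem_of_prefix {M ε : ℝ} (hM : ∀ i, F.ratio i ≤ M) (hε : M ≤ Real.exp (-ε))
    {u v : List (Fin A)} (h : u <+: v)
    (hr : F.wordRatio v / F.wordRatio u ∈ Set.Ioo (Real.exp (-ε)) (Real.exp ε)) : u = v := by
  obtain ⟨t, rfl⟩ := h
  rcases eq_or_ne t [] with rfl | ht
  · simp
  · rw [wordRatio_append, mul_div_cancel_left₀ _ (F.wordRatio_pos u).ne'] at hr
    exact absurd ((wordRatio_le_of_ne_nil hM ht).trans hε) (not_le.2 hr.1)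

theorem eq_of_div_mem {M ε : ℝ} (hM : ∀ i, F.ratio i ≤ M) (hε : M ≤ Real.exp (-ε))
    {u v : List (Fin A)} {ω : ℕ → Fin A} (hu : ω ∈ cylinder u) (hv : ω ∈ cylinder v)
    (hr : F.wordRatio u / F.wordRatio v ∈ Set.Ioo (Real.exp (-ε)) (Real.exp ε)) : u = v := by
  rcases prefix_or_prefix_of_mem hu hv with h | h
  · exact eq_of_div_mem_of_prefix hM hε h (div_mem_Ioo_exp_symm hr)
  · exact (eq_of_div_mem_of_prefix hM hε h hr).symm

/-- Relatively close squares of every precision exist. -/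
def HasCloseSquares [NeZero A] [NeZero B] (F : AffineIFS A) (G : AffineIFS B) (D : ℝ) : Prop :=
  ∀ ε : ℝ, 0 < ε → ∃ w₁ w₂ : List (Fin A) × List (Fin B), w₁ ≠ w₂ ∧
    F.IsDeltaSquare G ε w₁ ∧ F.IsDeltaSquare G ε w₂ ∧ F.RelativelyClose G D ε w₁ w₂

/-- The square condition and condition (i) make all four rates nearly equal, (ii) gives the two
squares a common relative orientation `σ`, and (iii) compares the translations. For small `ε`,
distinctness becomes disjointness. -/
theorem HasCloseSquares.exists_pair [NeZero A] [NeZero B] {D : ℝ} (hD : 0 ≤ D)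
    (h : HasCloseSquares F G D) {η : ℝ} (hη : 0 < η) :
    ∃ (σ : ℝ) (w : Bool → List (Fin A) × List (Fin B)), (σ = 1 ∨ σ = -1) ∧
      IsCluster F G 1 σ η w ∧ Pairwise fun i j => Disjoint (rect (w i)) (rect (w j)) := by
  obtain ⟨_, M₁, _, _, hM₁0, hM₁1, hM₁⟩ := F.exists_ratio_bounds
  obtain ⟨_, M₂, _, _, hM₂0, hM₂1, hM₂⟩ := G.exists_ratio_bounds
  set p := F.proj (extend []) with hp
  set q := G.proj (extend []) with hq
  set K := 8 + D + 2 * |p| + 6 * |q| with hK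
  have hK0 : 0 < K := by positivity
  -- `K` collects the constants of all error estimates below; the last two bounds serve the
  -- disjointness.
  obtain ⟨ε, hε0, hε1, hεη, hεM₁, hεM₂⟩ : ∃ ε : ℝ, 0 < ε ∧ ε ≤ 1 ∧ ε * K ≤ η ∧
      M₁ ≤ Real.exp (-ε) ∧ M₂ ≤ Real.exp (-ε) := by
    refine ⟨min (min 1 (η / K)) (min (-Real.log M₁) (-Real.log M₂)), lt_min (by positivity)
      (lt_min (neg_pos.2 (Real.log_neg hM₁0 hM₁1)) (neg_pos.2 (Real.log_neg hM₂0 hM₂1))),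
      (min_le_left _ _).trans (min_le_left _ _), ?_, ?_, ?_⟩
    · rw [← le_div_iff₀ hK0]
      exact (min_le_left _ _).trans (min_le_right _ _)
    · rw [← Real.log_le_iff_le_exp hM₁0, le_neg]
      exact (min_le_right _ _).trans (min_le_left _ _)
    · rw [← Real.log_le_iff_le_exp hM₂0, le_neg]
      exact (min_le_right _ _).trans (min_le_right _ _)
  obtain ⟨w₁, w₂, hne, hs₁, hs₂, ⟨hr₁, hr₂⟩, ⟨hsF, hsG⟩, hL⟩ := h ε hε0
  have l₁0 := F.wordRatio_pos w₁.1
  have l₂0 := F.wordRatio_pos w₂.1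
  have g₁0 := G.wordRatio_pos w₁.2
  have g₂0 := G.wordRatio_pos w₂.2
  have hdisj : Disjoint (rect w₁) (rect w₂) := by
    rw [Set.disjoint_left]
    intro x hx₁ hx₂
    exact hne (Prod.ext (eq_of_div_mem (fun i => (hM₁ i).2) hεM₁ hx₁.1 hx₂.1 hr₁)
      (eq_of_div_mem (fun i => (hM₂ i).2) hεM₂ hx₁.2 hx₂.2 hr₂))
  have k₁ := abs_sub_le_of_div_mem l₁0 hε1 (div_mem_Ioo_exp_symm hr₁)
  have k₂ := abs_sub_le_of_div_mem l₁0 hε1 (div_mem_Ioo_exp_symm hs₁)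
  have k₃ := abs_sub_le_of_div_mem l₂0 hε1 (div_mem_Ioo_exp_symm hs₂)
  have k₄ := abs_sub_le_of_div_mem g₁0 hε1 (div_mem_Ioo_exp_symm hr₂)
  set E := ε * F.wordRatio w₁.1 with hE
  have hE0 : 0 ≤ E := by positivity
  have hEl : E ≤ F.wordRatio w₁.1 := mul_le_of_le_one_left l₁0.le hε1
  have k₁' : |F.wordRatio w₂.1 - F.wordRatio w₁.1| ≤ 2 * E := k₁.trans_eq (by rw [hE]; ring)
  have k₂' : |G.wordRatio w₁.2 - F.wordRatio w₁.1| ≤ 2 * E := k₂.trans_eq (by rw [hE]; ring)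
  have hl₂ : ε * F.wordRatio w₂.1 ≤ 3 * E := by
    have : F.wordRatio w₂.1 ≤ 3 * F.wordRatio w₁.1 := by linarith [(abs_le.1 k₁').2]
    have := mul_le_mul_of_nonneg_left this hε0.le
    linarith
  have hg₁ : ε * G.wordRatio w₁.2 ≤ 3 * E := by
    have : G.wordRatio w₁.2 ≤ 3 * F.wordRatio w₁.1 := by linarith [(abs_le.1 k₂').2]
    have := mul_le_mul_of_nonneg_left this hε0.le
    linarith
  have k₃' : |G.wordRatio w₂.2 - F.wordRatio w₂.1| ≤ 6 * E := by linarith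
  have k₄' : |G.wordRatio w₂.2 - G.wordRatio w₁.2| ≤ 6 * E := by linarith
  have sF := F.abs_wordSign w₁.1
  have sG := G.abs_wordSign w₁.2
  have sFF := F.wordSign_mul_self w₁.1
  refine ⟨F.wordSign w₁.1 * G.wordSign w₁.2, fun b => if b then w₁ else w₂, ?_, ?_, ?_⟩
  · rcases F.wordSign_eq w₁.1 with h | h <;> rcases G.wordSign_eq w₁.2 with h' | h' <;>
      simp [h, h']
  · have hη' : ∀ {c : ℝ}, c ≤ ε * K * F.wordRatio w₁.1 → c ≤ η * |F.wordLin w₁.1| := fun hc => by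
      rw [abs_wordLin]
      exact hc.trans (mul_le_mul_of_nonneg_right hεη l₁0.le)
    have hnn : 0 ≤ η * |F.wordLin w₁.1| := by positivity
    have e : F.wordSign w₁.1 * G.wordSign w₁.2 * F.wordLin w₁.1 =
        G.wordSign w₁.2 * F.wordRatio w₁.1 := by
      rw [wordLin]
      linear_combination G.wordSign w₁.2 * F.wordRatio w₁.1 * sFF
    have hKE : ε * K * F.wordRatio w₁.1 = 8 * E + E * D + 2 * (E * |p|) + 6 * (E * |q|) := by
      rw [hK, hE]; ring
    have hED := mul_nonneg hE0 hD
    have hEp := mul_nonneg hE0 (abs_nonneg p)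
    have hEq := mul_nonneg hE0 (abs_nonneg q)
    refine ⟨F.wordLin w₁.1, F.wordMap w₁.1 0 + 1 * G.wordMap w₁.2 0, fun h0 => ?_, ?_⟩
    · have := F.abs_wordLin w₁.1
      rw [h0, abs_zero] at this
      exact l₁0.ne this
    rintro (_ | _)
    · simp only [Bool.false_eq_true, if_false]
      have i₁ : |F.wordLin w₂.1 - F.wordLin w₁.1| ≤ 2 * E := by
        rw [wordLin, wordLin, ← hsF, ← mul_sub, abs_mul, sF, one_mul]
        exact k₁'
      have i₂ : |G.wordLin w₂.2 - G.wordLin w₁.2| ≤ 6 * E := by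
        rw [wordLin, wordLin, ← hsG, ← mul_sub, abs_mul, sG, one_mul]
        exact k₄'
      refine ⟨hη' (i₁.trans (by linarith)), hη' ?_, hη' ?_⟩
      · rw [e, wordLin, ← hsG, ← mul_sub, abs_mul, sG, one_mul]
        have j₁ := abs_sub_le (G.wordRatio w₂.2) (F.wordRatio w₂.1) (F.wordRatio w₁.1)
        linarith
      · have hL' : |sumProj F G (extend w₁.1) (extend w₁.2) -
            sumProj F G (extend w₂.1) (extend w₂.2)| ≤ ε * D * F.wordRatio w₁.1 :=
          hL.le.trans (mul_le_mul_of_nonneg_left ((min_le_left _ _).trans (min_le_left _ _))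
            (by positivity))
        simp only [sumProj, F.proj_extend w₁.1, F.proj_extend w₂.1, G.proj_extend w₁.2,
          G.proj_extend w₂.2, ← hp, ← hq] at hL'
        rw [F.wordMap_eq w₁.1 p, F.wordMap_eq w₂.1 p, G.wordMap_eq w₁.2 q,
          G.wordMap_eq w₂.2 q] at hL'
        set L₁ := F.wordLin w₁.1 * p + F.wordMap w₁.1 0 +
          (G.wordLin w₁.2 * q + G.wordMap w₁.2 0)
        set L₂ := F.wordLin w₂.1 * p + F.wordMap w₂.1 0 +
          (G.wordLin w₂.2 * q + G.wordMap w₂.2 0)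
        -- Closeness is given for the images of `(p, q)`, while clusters compare images of the
        -- origin; the change of base point costs only differences of linear parts.
        have e' : F.wordMap w₂.1 0 + 1 * G.wordMap w₂.2 0 -
            (F.wordMap w₁.1 0 + 1 * G.wordMap w₁.2 0) =
            -(L₁ - L₂) - ((F.wordLin w₂.1 - F.wordLin w₁.1) * p +
              (G.wordLin w₂.2 - G.wordLin w₁.2) * q) := by
          simp only [L₁, L₂]; ring
        rw [e']
        have t₁ := abs_sub (-(L₁ - L₂)) ((F.wordLin w₂.1 - F.wordLin w₁.1) * p +
              (G.wordLin w₂.2 - G.wordLin w₁.2) * q)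
        rw [abs_neg] at t₁
        have t₂ := abs_add_le ((F.wordLin w₂.1 - F.wordLin w₁.1) * p)
              ((G.wordLin w₂.2 - G.wordLin w₁.2) * q)
        rw [abs_mul, abs_mul] at t₂
        have t₃ := mul_le_mul_of_nonneg_right i₁ (abs_nonneg p)
        have t₄ := mul_le_mul_of_nonneg_right i₂ (abs_nonneg q)
        have t₅ : ε * D * F.wordRatio w₁.1 = E * D := by rw [hE]; ring
        linarith
    · simp only [if_true, sub_self, abs_zero]
      refine ⟨hnn, hη' ?_, hnn⟩
      rw [e, wordLin, ← mul_sub, abs_mul, sG, one_mul]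
      linarith
  · rintro (_ | _) (_ | _) hij
    · exact absurd rfl hij
    · simpa using hdisj.symm
    · simpa using hdisj
    · exact absurd rfl hij

/-- If a pair has relative orientation `-1`, fix one of its members and append it to a second, much
narrower pair. If that one also has orientation `-1`, the signs cancel; otherwise it already serves
by itself. -/
theorem HasCloseSquares.exists_oriented_pair [NeZero A] [NeZero B] {D : ℝ} (hD : 0 ≤ D)
    (h : HasCloseSquares F G D) {η : ℝ} (hη : 0 < η) :
    ∃ w : Bool → List (Fin A) × List (Fin B), IsCluster F G 1 1 η w ∧
      Pairwise fun i j => Disjoint (rect (w i)) (rect (w j)) := by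
  have hε0 : 0 < min η 1 := lt_min hη one_pos
  obtain ⟨σ, w', hσ, hw', hd'⟩ := h.exists_pair hD (div_pos hε0 four_pos)
  rcases hσ with rfl | rfl
  · refine ⟨w', hw'.mono ?_, hd'⟩
    linarith [min_le_left η 1]
  have hs : IsCluster F G (-1) (-1) (min η 1 / 4) fun _ : Unit => w' true := by
    obtain ⟨a, t, ha, hw'⟩ := hw'
    refine ⟨a, F.wordMap (w' true).1 0 + -1 * G.wordMap (w' true).2 0, ha,
      fun _ => ⟨(hw' true).1, (hw' true).2.1, ?_⟩⟩
    rw [sub_self, abs_zero]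
    positivity
  obtain ⟨η₂, hη₂, happ⟩ := hs.exists_append (by simp) (by simp) hε0 (min_le_right _ _)
  obtain ⟨σ, w, hσ, hw, hd⟩ := h.exists_pair hD (lt_min hη₂ hη)
  rcases hσ with rfl | rfl
  · exact ⟨w, hw.mono (min_le_right _ _), hd⟩
  · refine ⟨fun b => pairAppend (w b) (w' true), ?_, fun i j hij =>
      (hd hij).mono (rect_append_subset _ _) (rect_append_subset _ _)⟩
    have := ((happ (hw.mono (min_le_left _ _))).mono (min_le_left η 1)).comp
      fun b : Bool => (b, ())
    rw [neg_mul_neg, one_mul] at this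
    exact this

/-- Each step appends an oriented pair to a cluster and doubles its size. The pair is fixed first
and dictates how narrow the cluster must be, so the induction runs over all `η`. -/
theorem HasCloseSquares.exists_cluster [NeZero A] [NeZero B] {D : ℝ} (hD : 0 ≤ D)
    (h : HasCloseSquares F G D) (k : ℕ) {η : ℝ} (hη : 0 < η) :
    ∃ (ι : Type) (_ : Fintype ι) (w : ι → List (Fin A) × List (Fin B)),
      Fintype.card ι = 2 ^ k ∧ IsCluster F G 1 1 η w ∧
      Pairwise fun i j => Disjoint (rect (w i)) (rect (w j)) := by
  induction k generalizing η with
  | zero =>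
    refine ⟨Unit, inferInstance, fun _ => ([], []), rfl, ⟨1, 0, one_ne_zero, fun _ => ?_⟩,
      fun i j hij => absurd (Subsingleton.elim i j) hij⟩
    simp [wordLin, hη.le]
  | succ k ih =>
    have hε0 : 0 < min η 1 := lt_min hη one_pos
    obtain ⟨w', hw', hd'⟩ := h.exists_oriented_pair hD (div_pos hε0 four_pos)
    obtain ⟨η₂, hη₂, happ⟩ := hw'.exists_append (by simp) (by simp) hε0 (min_le_right _ _)
    obtain ⟨ι, _, w, hcard, hw, hd⟩ := ih hη₂
    refine ⟨ι × Bool, inferInstance, fun p => pairAppend (w p.1) (w' p.2), ?_, ?_,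
      pairwise_disjoint_rect_append hd hd'⟩
    · simp [hcard, pow_succ]
    · have := (happ hw).mono (min_le_left η 1)
      rwa [one_mul] at this

end clusters

/-! ### Hausdorff content. -/

section content

open MeasureTheory

/-- The `d`-dimensional Hausdorff content on the line. -/
noncomputable def hausdorffContent (d : ℝ) : OuterMeasure ℝ :=
  OuterMeasure.boundedBy fun s => Metric.ediam s ^ d

/-- For `d > 0`, a cover with a small sum of `d`-th powers of diameters consists of small sets only,
so the content's covers are also admissible for the measure. -/
theorem hausdorffMeasure_eq_zero_of_content {d : ℝ} (hd : 0 < d) {s : Set ℝ}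
    (h : hausdorffContent d s = 0) : Measure.hausdorffMeasure d s = 0 := by
  let c : ℕ → ENNReal := fun n => ((n : ENNReal) + 1)⁻¹
  have hc0 : ∀ n, 0 < c n ^ d := fun n =>
    ENNReal.rpow_pos (ENNReal.inv_pos.2 (by simp)) (ENNReal.inv_ne_top.2 (by simp))
  have hcov : ∀ n, ∃ t : ℕ → Set ℝ, s ⊆ ⋃ i, t i ∧ ∑' i, Metric.ediam (t i) ^ d < c n ^ d := by
    intro n
    have h' := hc0 n
    rw [← h, hausdorffContent, OuterMeasure.boundedBy_apply] at h'
    obtain ⟨t, ht⟩ := iInf_lt_iff.1 h'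
    obtain ⟨hst, ht⟩ := iInf_lt_iff.1 ht
    refine ⟨t, hst, lt_of_le_of_lt (ENNReal.tsum_le_tsum fun i => ?_) ht⟩
    rcases (t i).eq_empty_or_nonempty with he | hne
    · simp [he, hd]
    · simp [hne]
  choose t hst ht using hcov
  have hc : Filter.Tendsto c Filter.atTop (nhds 0) := by
    have := (Filter.tendsto_add_atTop_iff_nat 1).2 ENNReal.tendsto_inv_nat_nhds_zero
    simpa [c] using this
  have hdiam : ∀ n i, Metric.ediam (t n i) ≤ c n := fun n i =>
    (ENNReal.rpow_le_rpow_iff hd).1 ((ENNReal.le_tsum i).trans (ht n).le)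
  have hcd : Filter.Tendsto (fun n => c n ^ d) Filter.atTop (nhds 0) := by
    have := ((ENNReal.continuous_rpow_const (y := d)).tendsto 0).comp hc
    rwa [ENNReal.zero_rpow_of_pos hd] at this
  have hle := Measure.hausdorffMeasure_le_liminf_tsum d s c hc t
    (Filter.Eventually.of_forall hdiam) (Filter.Eventually.of_forall hst)
  refine le_antisymm (hle.trans ?_) bot_le
  rw [← hcd.liminf_eq]
  exact Filter.liminf_le_liminf (Filter.Eventually.of_forall fun n => (ht n).le)

theorem hausdorffContent_le {d : ℝ} (hd : 0 ≤ d) {s : Set ℝ} {R : ℝ} (hR : 0 ≤ R)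
    (hs : ∀ x ∈ s, ∀ y ∈ s, |x - y| ≤ R) : hausdorffContent d s ≤ ENNReal.ofReal (R ^ d) := by
  refine (OuterMeasure.boundedBy_le s).trans ?_
  rw [← ENNReal.ofReal_rpow_of_nonneg hR hd]
  refine ENNReal.rpow_le_rpow (Metric.ediam_le fun x hx y hy => ?_) hd
  rw [edist_dist]
  exact ENNReal.ofReal_le_ofReal (hs x hx y hy)

end content

/-! ### Close squares make the content vanish. -/

section covering

open MeasureTheory

variable {F : AffineIFS A} {G : AffineIFS B}

/-- The mass of a rectangle for the product of the Bernoulli measures. -/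
noncomputable def mass (F : AffineIFS A) (G : AffineIFS B) (d₁ d₂ : ℝ)
    (w : List (Fin A) × List (Fin B)) : ℝ :=
  F.wordRatio w.1 ^ d₁ * G.wordRatio w.2 ^ d₂

theorem mass_pos (F : AffineIFS A) (G : AffineIFS B) (d₁ d₂ : ℝ)
    (w : List (Fin A) × List (Fin B)) : 0 < mass F G d₁ d₂ w :=
  mul_pos (Real.rpow_pos_of_pos (F.wordRatio_pos _) _) (Real.rpow_pos_of_pos (G.wordRatio_pos _) _)

theorem mass_pairAppend (F : AffineIFS A) (G : AffineIFS B) (d₁ d₂ : ℝ)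
    (w w' : List (Fin A) × List (Fin B)) :
    mass F G d₁ d₂ (pairAppend w w') = mass F G d₁ d₂ w * mass F G d₁ d₂ w' := by
  simp only [mass, pairAppend, wordRatio_append]
  rw [Real.mul_rpow (F.wordRatio_pos _).le (F.wordRatio_pos _).le,
    Real.mul_rpow (G.wordRatio_pos _).le (G.wordRatio_pos _).le]
  ring

theorem rpow_add_le_mass {d₁ d₂ s : ℝ} (hd₁ : 0 ≤ d₁) (hd₂ : 0 ≤ d₂) (hs : 0 < s)
    {w : List (Fin A) × List (Fin B)} (h₁ : s ≤ F.wordRatio w.1) (h₂ : s ≤ G.wordRatio w.2) :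
    s ^ (d₁ + d₂) ≤ mass F G d₁ d₂ w := by
  rw [Real.rpow_add hs]
  exact mul_le_mul (Real.rpow_le_rpow hs.le h₁ hd₁) (Real.rpow_le_rpow hs.le h₂ hd₂)
    (Real.rpow_nonneg hs.le _) (Real.rpow_nonneg (F.wordRatio_pos _).le _)

/-- The image of a set of pairs of sequences under `sumProj`. -/
def image (F : AffineIFS A) (G : AffineIFS B) (E : Set ((ℕ → Fin A) × (ℕ → Fin B))) : Set ℝ :=
  (fun x => sumProj F G x.1 x.2) '' E

/-- The stopping rectangles of level `r` partition sequence space and have bounded eccentricity.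
Subadditivity of `c` and additivity of `μ` pass the bound on to their unions. -/
theorem content_image_le_of_partition {m r : ℝ} (hm0 : 0 < m) (hm1 : m < 1)
    (hmF : ∀ i, m ≤ F.ratio i) (hmG : ∀ i, m ≤ G.ratio i) (hr0 : 0 < r) (hr1 : r ≤ 1)
    {μ : Measure ((ℕ → Fin A) × (ℕ → Fin B))} {c : OuterMeasure ℝ} {M : ENNReal}
    (hM : ∀ w, |logRatio F G w| ≤ -Real.log m → c (image F G (rect w)) ≤ M * μ (rect w))
    {E : Set ((ℕ → Fin A) × (ℕ → Fin B))}
    (hE : ∀ w : List (Fin A) × List (Fin B), w.1 ∈ F.stoppingWords r → w.2 ∈ G.stoppingWords r →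
      rect w ⊆ E ∨ Disjoint (rect w) E) :
    c (image F G E) ≤ M * μ E := by
  let I := {w : List (Fin A) × List (Fin B) // (w.1 ∈ F.stoppingWords r ∧
    w.2 ∈ G.stoppingWords r) ∧ rect w ⊆ E}
  have hcover : E = ⋃ w : I, rect w.1 := by
    refine Set.Subset.antisymm (fun x hx => ?_) (Set.iUnion_subset fun w => w.2.2)
    obtain ⟨u, hu, hxu⟩ := F.exists_mem_stoppingWords hr0 x.1
    obtain ⟨v, hv, hxv⟩ := G.exists_mem_stoppingWords hr0 x.2
    rcases hE (u, v) hu hv with h | h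
    · exact Set.mem_iUnion.2 ⟨⟨(u, v), ⟨hu, hv⟩, h⟩, hxu, hxv⟩
    · exact absurd hx (Set.disjoint_left.1 h ⟨hxu, hxv⟩)
  have hdisj : Pairwise fun w w' : I => Disjoint (rect w.1) (rect w'.1) := by
    intro w w' hne
    refine Set.disjoint_left.2 fun x hx hx' => hne (Subtype.ext (Prod.ext ?_ ?_))
    · exact eq_of_mem_stoppingWords w.2.1.1 w'.2.1.1 hx.1 hx'.1
    · exact eq_of_mem_stoppingWords w.2.1.2 w'.2.1.2 hx.2 hx'.2
  have hlog : ∀ w : I, |logRatio F G w.1| ≤ -Real.log m := fun w =>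
    logRatio_le_of_mem_Icc hm0 hr0
      ⟨mul_le_of_mem_stoppingWords hm0 hm1 hmF hr1 w.2.1.1, w.2.1.1.1⟩
      ⟨mul_le_of_mem_stoppingWords hm0 hm1 hmG hr1 w.2.1.2, w.2.1.2.1⟩
  have himage : image F G E = ⋃ w : I, image F G (rect w.1) := by
    conv_lhs => rw [hcover]
    exact Set.image_iUnion
  calc c (image F G E) = c (⋃ w : I, image F G (rect w.1)) := by rw [himage]
    _ ≤ ∑' w : I, c (image F G (rect w.1)) := measure_iUnion_le _
    _ ≤ ∑' w : I, M * μ (rect w.1) := ENNReal.tsum_le_tsum fun w => hM _ (hlog w)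
    _ = M * μ E := by
        rw [ENNReal.tsum_mul_left]
        conv_rhs => rw [hcover]
        rw [measure_iUnion hdisj fun w => measurableSet_rect _]

theorem exists_stopping_level {ι : Type*} [Fintype ι] {m : ℝ} (hm0 : 0 < m) (hm1 : m < 1)
    (hmF : ∀ i, m ≤ F.ratio i) (hmG : ∀ i, m ≤ G.ratio i)
    (q : ι → List (Fin A) × List (Fin B)) :
    ∃ r, 0 < r ∧ r ≤ 1 ∧ ∀ w : List (Fin A) × List (Fin B), w.1 ∈ F.stoppingWords r →
      w.2 ∈ G.stoppingWords r → ∀ i, rect w ⊆ rect (q i) ∨ Disjoint (rect w) (rect (q i)) := by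
  let n := ∑ i, ((q i).1.length + (q i).2.length)
  have hn : ∀ i, (q i).1.length + (q i).2.length ≤ n := fun i =>
    Finset.single_le_sum (f := fun i => (q i).1.length + (q i).2.length)
      (fun _ _ => Nat.zero_le _) (Finset.mem_univ i)
  refine ⟨m ^ n, by positivity, pow_le_one₀ hm0.le hm1.le, fun w h₁ h₂ i => ?_⟩
  have l₁ := length_le_of_mem_stoppingWords hm0 hm1 hmF le_rfl h₁
  have l₂ := length_le_of_mem_stoppingWords hm0 hm1 hmG le_rfl h₂
  have hi := hn i
  rcases cylinder_subset_or_disjoint (show (q i).1.length ≤ w.1.length by omega) with h | h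
  · rcases cylinder_subset_or_disjoint (show (q i).2.length ≤ w.2.length by omega) with h' | h'
    · exact Or.inl (Set.prod_mono h h')
    · exact Or.inr (Set.disjoint_prod.2 (Or.inr h'))
  · exact Or.inr (Set.disjoint_prod.2 (Or.inl h))

/-- A bound for the content of images of rectangles improves if a part of each rectangle has a
better bound. -/
theorem content_image_rect_le {ι : Type*} [Fintype ι] {m : ℝ} (hm0 : 0 < m) (hm1 : m < 1)
    (hmF : ∀ i, m ≤ F.ratio i) (hmG : ∀ i, m ≤ G.ratio i) {d₁ d₂ : ℝ}
    {μ : Measure ((ℕ → Fin A) × (ℕ → Fin B))}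
    (hμ : ∀ w, μ (rect w) = ENNReal.ofReal (mass F G d₁ d₂ w)) {c : OuterMeasure ℝ}
    {M b κ : ℝ} (hb : 0 ≤ b) (hbM : b ≤ M)
    (hM : ∀ w, |logRatio F G w| ≤ -Real.log m →
      c (image F G (rect w)) ≤ ENNReal.ofReal (M * mass F G d₁ d₂ w))
    {R : List (Fin A) × List (Fin B)} {q : ι → List (Fin A) × List (Fin B)}
    (hq : ∀ i, rect (q i) ⊆ rect R)
    (hdisj : Pairwise fun i j => Disjoint (rect (q i)) (rect (q j)))
    (hqb : c (image F G (⋃ i, rect (q i))) ≤ ENNReal.ofReal (b * ∑ i, mass F G d₁ d₂ (q i)))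
    (hκ : κ * mass F G d₁ d₂ R ≤ ∑ i, mass F G d₁ d₂ (q i)) :
    c (image F G (rect R)) ≤ ENNReal.ofReal ((b + (1 - κ) * (M - b)) * mass F G d₁ d₂ R) := by
  have hM0 : 0 ≤ M := hb.trans hbM
  set g := ∑ i, mass F G d₁ d₂ (q i) with hg
  have hg0 : 0 ≤ g := Finset.sum_nonneg fun i _ => (mass_pos F G d₁ d₂ _).le
  have hmeas : MeasurableSet (⋃ i, rect (q i)) := MeasurableSet.iUnion fun i => measurableSet_rect _
  have hμU : μ (⋃ i, rect (q i)) = ENNReal.ofReal g := by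
    rw [measure_iUnion hdisj fun i => measurableSet_rect _, tsum_fintype, hg,
      ENNReal.ofReal_sum_of_nonneg fun i _ => (mass_pos F G d₁ d₂ _).le]
    exact Finset.sum_congr rfl fun i _ => hμ _
  have hsub : (⋃ i, rect (q i)) ⊆ rect R := Set.iUnion_subset hq
  have hgR : g ≤ mass F G d₁ d₂ R := by
    have := measure_mono (μ := μ) hsub
    rw [hμU, hμ] at this
    exact (ENNReal.ofReal_le_ofReal_iff (mass_pos F G d₁ d₂ R).le).1 this
  have hμE : μ (rect R \ ⋃ i, rect (q i)) = ENNReal.ofReal (mass F G d₁ d₂ R - g) := by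
    rw [measure_sdiff hsub hmeas.nullMeasurableSet (by rw [hμU]; exact ENNReal.ofReal_ne_top),
      hμU, hμ, ENNReal.ofReal_sub _ hg0]
  -- A level fine enough for `R` and all `q i` at once, so that the remainder is a union of stopping
  -- rectangles.
  obtain ⟨r, hr0, hr1, hr⟩ := exists_stopping_level hm0 hm1 hmF hmG
    (fun o : Option ι => o.elim R q)
  have hrest : c (image F G (rect R \ ⋃ i, rect (q i))) ≤
      ENNReal.ofReal (M * (mass F G d₁ d₂ R - g)) := by
    rw [ENNReal.ofReal_mul hM0, ← hμE]
    refine content_image_le_of_partition hm0 hm1 hmF hmG hr0 hr1 (fun w hw => ?_) fun w h₁ h₂ => ?_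
    · rw [hμ, ← ENNReal.ofReal_mul hM0]
      exact hM w hw
    · rcases hr w h₁ h₂ none with h | h
      · by_cases hi : ∃ i, rect w ⊆ rect (q i)
        · obtain ⟨i, hi⟩ := hi
          exact Or.inr (Set.disjoint_left.2 fun x hx hx' => hx'.2 (Set.mem_iUnion.2 ⟨i, hi hx⟩))
        · push Not at hi
          refine Or.inl fun x hx => ⟨h hx, fun hx' => ?_⟩
          obtain ⟨i, hxi⟩ := Set.mem_iUnion.1 hx'
          exact Set.disjoint_left.1 ((hr w h₁ h₂ (some i)).resolve_left (hi i)) hx hxi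
      · exact Or.inr (h.mono_right Set.sdiff_subset)
  have hsplit : image F G (rect R) =
      image F G (⋃ i, rect (q i)) ∪ image F G (rect R \ ⋃ i, rect (q i)) := by
    rw [image, image, image, ← Set.image_union, Set.union_sdiff_cancel hsub]
  rw [hsplit]
  refine (measure_union_le _ _).trans ((add_le_add hqb hrest).trans ?_)
  rw [← ENNReal.ofReal_add (mul_nonneg hb hg0) (mul_nonneg hM0 (sub_nonneg.2 hgR))]
  refine ENNReal.ofReal_le_ofReal ?_
  nlinarith [mul_le_mul_of_nonneg_left hκ (sub_nonneg.2 hbM)]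

/-- All rectangles project into one interval of length comparable to `|a|`, while each has mass at
least `(|a| / 2) ^ (d₁ + d₂)`. The gain is the number of rectangles. -/
theorem content_image_cluster_le {ι : Type*} [Fintype ι] {X Y : ℝ}
    (hX : ∀ ω, |F.proj ω| ≤ X) (hY : ∀ τ, |G.proj τ| ≤ Y) (hX0 : 0 ≤ X) (hY0 : 0 ≤ Y)
    {d₁ d₂ : ℝ} (hd₁ : 0 ≤ d₁) (hd₂ : 0 ≤ d₂) [Nonempty ι]
    {q : ι → List (Fin A) × List (Fin B)} (hq : IsCluster F G 1 1 (1 / 2) q) :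
    hausdorffContent (d₁ + d₂) (image F G (⋃ i, rect (q i))) ≤
      ENNReal.ofReal ((2 * (3 * X + 3 * Y + 1)) ^ (d₁ + d₂) / Fintype.card ι *
        ∑ i, mass F G d₁ d₂ (q i)) := by
  obtain ⟨a, t, ha, h⟩ := hq
  have ha0 : 0 < |a| := abs_pos.2 ha
  have hball : ∀ z ∈ image F G (⋃ i, rect (q i)),
      |z - t| ≤ |a| * (3 * X + 3 * Y + 1) / 2 := by
    rintro _ ⟨x, hx, rfl⟩
    obtain ⟨i, hxi⟩ := Set.mem_iUnion.1 hx
    obtain ⟨h₁, h₂, h₃⟩ := h i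
    simp only [sumProj]
    rw [F.proj_eq_of_mem_cylinder hxi.1, G.proj_eq_of_mem_cylinder hxi.2, F.wordMap_eq,
      G.wordMap_eq]
    have hp := hX fun k => x.1 ((q i).1.length + k)
    have hp' := hY fun k => x.2 ((q i).2.length + k)
    set p := F.proj fun k => x.1 ((q i).1.length + k)
    set p' := G.proj fun k => x.2 ((q i).2.length + k)
    rw [one_mul] at h₂ h₃
    have l₁ : |F.wordLin (q i).1| ≤ 3 / 2 * |a| := by
      linarith [abs_sub_abs_le_abs_sub (F.wordLin (q i).1) a]
    have l₂ : |G.wordLin (q i).2| ≤ 3 / 2 * |a| := by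
      linarith [abs_sub_abs_le_abs_sub (G.wordLin (q i).2) a]
    have e : F.wordLin (q i).1 * p + F.wordMap (q i).1 0 +
        (G.wordLin (q i).2 * p' + G.wordMap (q i).2 0) - t =
        (F.wordLin (q i).1 * p + G.wordLin (q i).2 * p') +
        (F.wordMap (q i).1 0 + G.wordMap (q i).2 0 - t) := by ring
    rw [e]
    have t₁ := abs_add_le (F.wordLin (q i).1 * p + G.wordLin (q i).2 * p')
      (F.wordMap (q i).1 0 + G.wordMap (q i).2 0 - t)
    have t₂ := abs_add_le (F.wordLin (q i).1 * p) (G.wordLin (q i).2 * p')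
    rw [abs_mul, abs_mul] at t₂
    have t₃ := mul_le_mul l₁ hp (abs_nonneg _) (by positivity)
    have t₄ := mul_le_mul l₂ hp' (abs_nonneg _) (by positivity)
    linarith
  set K := 3 * X + 3 * Y + 1
  have hK0 : 0 < K := by positivity
  refine (hausdorffContent_le (add_nonneg hd₁ hd₂) (by positivity : 0 ≤ |a| * K)
    fun x hx y hy => ?_).trans (ENNReal.ofReal_le_ofReal ?_)
  · have := abs_sub_le x t y
    rw [abs_sub_comm t y] at this
    linarith [hball x hx, hball y hy]
  · have hmass : ∀ i, (|a| / 2) ^ (d₁ + d₂) ≤ mass F G d₁ d₂ (q i) := by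
      intro i
      obtain ⟨h₁, h₂, -⟩ := h i
      rw [one_mul] at h₂
      refine rpow_add_le_mass hd₁ hd₂ (by positivity) ?_ ?_
      · rw [← abs_wordLin]
        rw [abs_sub_comm] at h₁
        linarith [abs_sub_abs_le_abs_sub a (F.wordLin (q i).1)]
      · rw [← abs_wordLin]
        rw [abs_sub_comm] at h₂
        linarith [abs_sub_abs_le_abs_sub a (G.wordLin (q i).2)]
    have hsum : Fintype.card ι * (|a| / 2) ^ (d₁ + d₂) ≤ ∑ i, mass F G d₁ d₂ (q i) := by
      rw [← nsmul_eq_mul, ← Finset.card_univ]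
      exact Finset.card_nsmul_le_sum _ _ _ fun i _ => hmass i
    have hcard : (0 : ℝ) < Fintype.card ι := by exact_mod_cast Fintype.card_pos
    rw [div_mul_eq_mul_div, le_div_iff₀ hcard]
    calc (|a| * K) ^ (d₁ + d₂) * Fintype.card ι
        = (2 * K) ^ (d₁ + d₂) * (Fintype.card ι * (|a| / 2) ^ (d₁ + d₂)) := by
          rw [show |a| * K = 2 * K * (|a| / 2) by ring, Real.mul_rpow (by positivity)
            (by positivity)]
          ring
      _ ≤ _ := mul_le_mul_of_nonneg_left hsum (by positivity)

theorem content_image_rect_le_mass {X Y : ℝ}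
    (hX : ∀ ω, |F.proj ω| ≤ X) (hY : ∀ τ, |G.proj τ| ≤ Y) (hX0 : 0 ≤ X) (hY0 : 0 ≤ Y)
    {d₁ d₂ : ℝ} (hd₁ : 0 ≤ d₁) (hd₂ : 0 ≤ d₂) {T : ℝ} (hT : 0 ≤ T)
    {w : List (Fin A) × List (Fin B)} (hw : |logRatio F G w| ≤ T) :
    hausdorffContent (d₁ + d₂) (image F G (rect w)) ≤
      ENNReal.ofReal ((Real.exp T * (2 * X + 2 * Y)) ^ (d₁ + d₂) * mass F G d₁ d₂ w) := by
  have l0 := F.wordRatio_pos w.1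
  have g0 := G.wordRatio_pos w.2
  have hexp : ∀ {x y : ℝ}, 0 < x → 0 < y → Real.log x - Real.log y ≤ T → x ≤ Real.exp T * y := by
    intro x y hx hy h
    rw [← Real.log_le_log_iff hx (by positivity), Real.log_mul (Real.exp_pos T).ne' hy.ne',
      Real.log_exp]
    linarith
  rw [logRatio, abs_le] at hw
  set s := min (F.wordRatio w.1) (G.wordRatio w.2) with hs
  have hs0 : 0 < s := lt_min l0 g0
  have hself : ∀ {x : ℝ}, 0 < x → x ≤ Real.exp T * x := fun hx =>
    le_mul_of_one_le_left hx.le (Real.one_le_exp hT)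
  have hl : F.wordRatio w.1 ≤ Real.exp T * s := by
    rcases min_cases (F.wordRatio w.1) (G.wordRatio w.2) with ⟨h, -⟩ | ⟨h, -⟩ <;> rw [hs, h]
    · exact hself l0
    · exact hexp l0 g0 hw.2
  have hg : G.wordRatio w.2 ≤ Real.exp T * s := by
    rcases min_cases (F.wordRatio w.1) (G.wordRatio w.2) with ⟨h, -⟩ | ⟨h, -⟩ <;> rw [hs, h]
    · exact hexp g0 l0 (by linarith [hw.1])
    · exact hself g0
  refine (hausdorffContent_le (add_nonneg hd₁ hd₂)
    (by positivity : 0 ≤ Real.exp T * (2 * X + 2 * Y) * s) ?_).trans (ENNReal.ofReal_le_ofReal ?_)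
  · rintro _ ⟨x, hx, rfl⟩ _ ⟨y, hy, rfl⟩
    refine (abs_sumProj_sub_le hX hY hx hy).trans ?_
    have h₁ := mul_le_mul_of_nonneg_right hl (by positivity : 0 ≤ 2 * X)
    have h₂ := mul_le_mul_of_nonneg_right hg (by positivity : 0 ≤ 2 * Y)
    linarith
  · rw [Real.mul_rpow (by positivity) hs0.le]
    exact mul_le_mul_of_nonneg_left (rpow_add_le_mass hd₁ hd₂ hs0 (min_le_left _ _)
      (min_le_right _ _)) (by positivity)

theorem isCluster_unit_of_balanced {η : ℝ} {w : List (Fin A) × List (Fin B)}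
    (h₁ : F.wordSign w.1 = 1) (h₂ : G.wordSign w.2 = 1)
    (h : |logRatio F G w| < min 1 (η / 2)) : IsCluster F G 1 1 η fun _ : Unit => w := by
  have l0 := F.wordRatio_pos w.1
  have hη : 0 < η := by
    have := (abs_nonneg _).trans_lt (h.trans_le (min_le_right _ _))
    linarith
  have hsq := (isDeltaSquare_iff F G w).2 h
  have := abs_sub_le_of_div_mem l0 (min_le_left _ _) (div_mem_Ioo_exp_symm hsq)
  refine ⟨F.wordLin w.1, F.wordMap w.1 0 + 1 * G.wordMap w.2 0, fun h0 => ?_, fun _ => ⟨?_, ?_, ?_⟩⟩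
  · have := F.abs_wordLin w.1
    rw [h0, abs_zero] at this
    exact l0.ne this
  · rw [sub_self, abs_zero]; positivity
  · rw [abs_wordLin, wordLin, wordLin, h₁, h₂, one_mul, one_mul, one_mul]
    refine this.trans (mul_le_mul_of_nonneg_right ?_ l0.le)
    linarith [min_le_right 1 (η / 2)]
  · rw [sub_self, abs_zero]; positivity

/-- For fixed `k`, the content per unit of mass starts at a crude constant, and its excess over `K /
2 ^ k` shrinks by `1 - κ` in each round. First the rounds, then `k`, go to infinity. -/
theorem HasCloseSquares.content_eq_zero [NeZero A] [NeZero B] {D : ℝ} (hD : 0 ≤ D)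
    (h : HasCloseSquares F G D) {C₁ C₂ : Set ℝ} (hC₁ : F.IsAttractor C₁)
    (hC₂ : G.IsAttractor C₂) {d₁ d₂ : ℝ} (hd₁ : F.IsSimilarityDim d₁)
    (hd₂ : G.IsSimilarityDim d₂) : hausdorffContent (d₁ + d₂) (C₁ + C₂) = 0 := by
  obtain ⟨X, hX0, hX⟩ := hC₁.exists_bound
  obtain ⟨Y, hY0, hY⟩ := hC₂.exists_bound
  replace hX : ∀ ω, |F.proj ω| ≤ X := fun ω => hX _ (hC₁.proj_mem ω)
  replace hY : ∀ τ, |G.proj τ| ≤ Y := fun τ => hY _ (hC₂.proj_mem τ)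
  obtain ⟨m, hm0, hm1, hmF, hmG⟩ := exists_common_ratio_bound F G
  have hT : 0 ≤ -Real.log m := neg_nonneg.2 (Real.log_nonpos hm0.le hm1.le)
  obtain ⟨μ, hμP, hμ⟩ := exists_product_bernoulli F G hd₁ hd₂
  have hd₁0 := hd₁.nonneg
  have hd₂0 := hd₂.nonneg
  set K := (2 * (3 * X + 3 * Y + 1)) ^ (d₁ + d₂) with hK
  have hK0 : 0 ≤ K := by positivity
  set C₀ := (Real.exp (-Real.log m) * (2 * X + 2 * Y)) ^ (d₁ + d₂) with hC₀
  have hC₀0 : 0 ≤ C₀ := by positivity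
  have main : ∀ (k : ℕ) (R : List (Fin A) × List (Fin B)), |logRatio F G R| ≤ -Real.log m →
      hausdorffContent (d₁ + d₂) (image F G (rect R)) ≤
        ENNReal.ofReal (K / 2 ^ k * mass F G d₁ d₂ R) := by
    intro k
    -- Precision `1 / 8` leaves room to put a nearly square word pair in front and still have a `1 /
    -- 2`-cluster.
    obtain ⟨ι, _, w, hcard, hw, hdisj⟩ := h.exists_cluster hD k
      (by norm_num : (0 : ℝ) < 1 / 2 / 4)
    have hne : Nonempty ι := Fintype.card_pos_iff.1 (by rw [hcard]; positivity)
    obtain ⟨i₀⟩ := id hne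
    obtain ⟨η, hη, happ⟩ := hw.exists_append (by simp) (by simp) (by norm_num : (0 : ℝ) < 1 / 2)
      (by norm_num)
    obtain ⟨κ₀, hκ₀, hext⟩ := exists_uniform_balanced_extension F G
      (lt_min one_pos (half_pos hη)) (-Real.log m)
    -- A lower bound, uniform in `R`, for the share of the mass of `R` filled by the cluster; the
    -- single member `i₀` already provides it.
    set κ := min 1 (κ₀ ^ (d₁ + d₂) * mass F G d₁ d₂ (w i₀)) with hκ
    have hκ0 : 0 < κ := lt_min one_pos (mul_pos (by positivity) (mass_pos _ _ _ _ _))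
    have hκ1 : κ ≤ 1 := min_le_left _ _
    have hb0 : 0 ≤ K / 2 ^ k := by positivity
    have iter : ∀ (n : ℕ) (R : List (Fin A) × List (Fin B)), |logRatio F G R| ≤ -Real.log m →
        hausdorffContent (d₁ + d₂) (image F G (rect R)) ≤
          ENNReal.ofReal ((K / 2 ^ k + (1 - κ) ^ n * C₀) * mass F G d₁ d₂ R) := by
      intro n
      induction n with
      | zero =>
        intro R hR
        refine (content_image_rect_le_mass hX hY hX0.le hY0.le hd₁0 hd₂0 hT hR).trans
          (ENNReal.ofReal_le_ofReal (mul_le_mul_of_nonneg_right ?_ (mass_pos _ _ _ _ _).le))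
        rw [pow_zero, one_mul]
        linarith
      | succ n ih =>
        intro R hR
        obtain ⟨e, he₁, he₂, he₃, he₄, he₅⟩ := hext R hR
        have hcl := ((happ (isCluster_unit_of_balanced (w := pairAppend R e) he₁ he₂ he₃)).comp
          fun i : ι => ((), i))
        rw [one_mul] at hcl
        have hq := content_image_cluster_le hX hY hX0.le hY0.le hd₁0 hd₂0 hcl
        rw [hcard, Nat.cast_pow, Nat.cast_ofNat] at hq
        have hpow : 0 ≤ (1 - κ) ^ n * C₀ := mul_nonneg (pow_nonneg (sub_nonneg.2 hκ1) _) hC₀0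
        have := content_image_rect_le hm0 hm1 hmF hmG hμ (κ := κ) hb0
          (le_add_of_nonneg_right hpow) ih (R := R) (fun i => (rect_append_subset _ _).trans
            (rect_append_subset _ _)) (fun i j hij => disjoint_rect_append _ (hdisj hij)) hq ?_
        · refine this.trans_eq ?_
          congr 2
          ring
        · refine le_trans ?_ (Finset.single_le_sum (fun i _ => (mass_pos F G d₁ d₂ _).le)
            (Finset.mem_univ i₀))
          simp only [mass_pairAppend]
          have h₁ := rpow_add_le_mass (F := F) (G := G) hd₁0 hd₂0 hκ₀ he₄ he₅
          have h₂ := mul_le_mul_of_nonneg_right h₁ (mass_pos F G d₁ d₂ (w i₀)).le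
          have h₃ := mul_le_mul_of_nonneg_left ((min_le_right _ _).trans h₂ : κ ≤ _)
            (mass_pos F G d₁ d₂ R).le
          linarith
    intro R hR
    have hlim : Filter.Tendsto (fun n : ℕ => ENNReal.ofReal
        ((K / 2 ^ k + (1 - κ) ^ n * C₀) * mass F G d₁ d₂ R)) Filter.atTop
        (nhds (ENNReal.ofReal ((K / 2 ^ k + 0 * C₀) * mass F G d₁ d₂ R))) :=
      ENNReal.tendsto_ofReal ((((tendsto_pow_atTop_nhds_zero_of_lt_one (sub_nonneg.2 hκ1)
        (sub_lt_self 1 hκ0)).mul_const C₀).const_add _).mul_const _)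
    rw [zero_mul, add_zero] at hlim
    exact ge_of_tendsto' hlim fun n => iter n R hR
  have hsub : C₁ + C₂ ⊆ image F G (rect ([], [])) := by
    rintro _ ⟨x, hx, y, hy, rfl⟩
    obtain ⟨ω, rfl⟩ := hC₁.exists_proj_eq hx
    obtain ⟨τ, rfl⟩ := hC₂.exists_proj_eq hy
    exact ⟨(ω, τ), ⟨by simp [cylinder, digits], by simp [cylinder, digits]⟩, rfl⟩
  have hlim : Filter.Tendsto (fun k : ℕ => ENNReal.ofReal
      (K / 2 ^ k * mass F G d₁ d₂ ([], []))) Filter.atTop (nhds 0) := by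
    have := ENNReal.tendsto_ofReal (((tendsto_pow_atTop_nhds_zero_of_lt_one
      (by norm_num : (0 : ℝ) ≤ 1 / 2) (by norm_num)).const_mul K).mul_const
      (mass F G d₁ d₂ ([], [])))
    simpa [div_eq_mul_inv] using this
  refine le_antisymm (ge_of_tendsto' hlim fun k => (measure_mono hsub).trans (main k _ ?_)) bot_le
  simpa [logRatio] using hT

end covering

end AffineIFS

/-! ### The equivalence. -/

theorem theorem1 {A B : ℕ} [NeZero A] [NeZero B] (F : AffineIFS A) (G : AffineIFS B)
    (C₁ C₂ : Set ℝ) (hC₁ : F.IsAttractor C₁) (hC₂ : G.IsAttractor C₂)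
    (hC : C₁.Nontrivial ∨ C₂.Nontrivial)
    (d₁ d₂ : ℝ) (hd₁ : F.IsSimilarityDim d₁) (hd₂ : G.IsSimilarityDim d₂) :
    MeasureTheory.Measure.hausdorffMeasure (d₁ + d₂) (C₁ + C₂) = 0 ↔
      ∀ ε : ℝ, 0 < ε → ∃ w₁ w₂ : List (Fin A) × List (Fin B), w₁ ≠ w₂ ∧
        F.IsDeltaSquare G ε w₁ ∧ F.IsDeltaSquare G ε w₂ ∧
        F.RelativelyClose G (max (Metric.diam C₁) (Metric.diam C₂)) ε w₁ w₂ := by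
  have hD : 0 < max (Metric.diam C₁) (Metric.diam C₂) := by
    rcases hC with h | h
    · exact lt_max_of_lt_left (Metric.diam_pos h hC₁.2.1.isBounded)
    · exact lt_max_of_lt_right (Metric.diam_pos h hC₂.2.1.isBounded)
  constructor
  · intro h0
    by_contra! hcon
    obtain ⟨ε, hε, hcon⟩ := hcon
    obtain ⟨X, -, hX⟩ := hC₁.exists_bound
    obtain ⟨Y, -, hY⟩ := hC₂.exists_bound
    obtain ⟨m, hm0, hm1, hmF, hmG⟩ := AffineIFS.exists_common_ratio_bound F G
    obtain ⟨N, hN⟩ := AffineIFS.exists_packing_bound (fun ω => hX _ (hC₁.proj_mem ω))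
      (fun τ => hY _ (hC₂.proj_mem τ)) hm0 hm1 hmF hmG hD hε hcon
    exact (AffineIFS.hausdorffMeasure_pos_of_packing_bound hC₁ hC₂ hd₁ hd₂ hN).ne' h0
  · intro h
    have hd : 0 < d₁ + d₂ := by
      rcases hC with h | h
      · exact add_pos_of_pos_of_nonneg (hd₁.pos hC₁ h) hd₂.nonneg
      · exact add_pos_of_nonneg_of_pos hd₁.nonneg (hd₂.pos hC₂ h)
    exact AffineIFS.hausdorffMeasure_eq_zero_of_content hd
      (AffineIFS.HasCloseSquares.content_eq_zero hD.le h hC₁ hC₂ hd₁ hd₂)
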